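/- **Setting.** All rings are commutative with unit. A differential ring $(R,\partial)$ is a ring with a derivation; its constants are $\mathrm{Const}_\partial(R)=\ker\partial$. An *integro-differential ring* $(S,\partial,\int)$ is a differential ring with a $\mathrm{Const}_\partial(S)$-linear map $\int\colon S\to S$ such that $\partial\int=\mathrm{id}$; its *evaluation* is $\mathrm{E}=\mathrm{id}-\int\partial$. Homomorphisms of integro-differential rings are unital ring homomorphisms commuting with $\partial$ and $\int$. Let $(R,\partial)$ be a differential ring with constants $C$, and let $Q\colon R\to R$ be a quasi-integration, i.e. a $C$-linear map with $\partial Q\partial=\partial$ and $Q\partial Q=Q$. Put $R_J=QR$ and $R_T=\ker Q$. All tensor products below are over $C$. **The free integro-differential ring $\mathrm{IDR}(R)$.** Let $T=\bigoplus_{n\ge0}R_T^{\otimes n}$, with empty tensor $1_T$ and shuffle product $\mathbin{\sqcup\!\sqcup}$, and $\widetilde T=\bigoplus_{n\ge1}R_T^{\otimes n}$. For a pure tensor $f=f_1\otimes\dots\otimes f_n$ write $f_i^j=f_i\otimes\dots\otimes f_j$, with $f_{j+1}^{j}=1_T$. Let $C_1=\mathrm{Sym}_C(R_J\otimes T)$,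 with generators denoted $\varepsilon(u)$, $u\in R_J\otimes T$. Let $C_2$ be the quotient of $\mathrm{Sym}_C(\widetilde T\odot\widetilde T)$ (where $\odot$ is the symmetric product over $C$, and generators are denoted $\varepsilon(f\odot g)$) by the ideal generated by $$\varepsilon((f\mathbin{\sqcup\!\sqcup} g)\odot h)-\varepsilon(f\odot(g\mathbin{\sqcup\!\sqcup} h))+\sum_{j=0}^{m-1}\Big(\sum_{i=\max(0,1-j)}^{n-1}\varepsilon(f_{i+1}^n\odot g_{j+1}^m)\,\varepsilon((f_1^i\mathbin{\sqcup\!\sqcup} g_1^j)\odot h)-\sum_{k=\max(0,1-j)}^{l-1}\varepsilon(f\odot(g_1^j\mathbin{\sqcup\!\sqcup} h_1^k))\,\varepsilon(g_{j+1}^m\odot h_{k+1}^l)\Big)$$ for all pure tensors $f,g,h\in\widetilde T$ of lengths $n,m,l\ge1$. The module $C_2\otimes T$ is a commutative $C$-algebra with $$(c\otimes f)(d\otimes g)=cd\otimes(f\mathbin{\sqcup\!\sqcup} g)+\sum_{i=0}^{n-1}\sum_{j=0}^{m-1}cd\,\varepsilon(f_{i+1}^n\odot g_{j+1}^m)\otimes(f_1^i\mathbin{\sqcup\!\sqcup}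 g_1^j)$$ for $c,d\in C_2$ and pure tensors $f,g\in T$ of lengths $n,m\ge0$. Let $$\mathrm{IDR}(R)=R\otimes C_1\otimes(C_2\otimes T)$$ be the tensor product of these $C$-algebras, and let $\iota(f)=f\otimes1\otimes1\otimes1_T$. It is an integro-differential ring with the following operations, defined for $f_0\in R$, $c=c_1\otimes c_2\in C_1\otimes C_2$ and a pure tensor $f\in T$ of length $n$, and extended additively: $$\partial(f_0\otimes c\otimes f)=\partial f_0\otimes c\otimes f+f_0f_1\otimes c\otimes f_2^n,$$ $$\int(f_0\otimes c\otimes f)=Qf_0\otimes c\otimes f-1\otimes c_1\varepsilon(Qf_0\otimes f)\otimes c_2\otimes1_T-\int\big((Qf_0)f_1\otimes c\otimes f_2^n\big)+1\otimes c\otimes\big((f_0-\partial Qf_0)\otimes f\big),$$ where the terms containing $f_2^n$ are omitted if $n=0$. **Theorem.** Let $(S,\partial,\int)$ be an integro-differential ring such that $(S,\partial)$ is a differential ring extension of $(R,\partial)$. Let $\bar R\subseteq S$ be the internal integro-differential closure of $R$ in $S$, i.e. the smallest subring of $S$ that contains $R$ and is closed under $\partial$ and $\int$. Assume that 1. $\bar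 R$ has no new constants: $\mathrm{Const}_\partial(\bar R)=C$; 2. $R_T$ is a free $C$-module with basis $\{a_i\mid i\in I\}$; 3. for every nonzero $f\in R$, the differential ideal of $R$ generated by $f$ contains a nonzero constant. For a word $W=w_1\cdots w_n$ over $I$ let $\tau(W)=a_{w_1}\otimes\dots\otimes a_{w_n}\in T$ and $\sigma(W)=\int a_{w_1}\int a_{w_2}\cdots\int a_{w_n}\in S$, with $\tau(W)=1_T$ and $\sigma(W)=1$ for the empty word. Let $J$ be the ideal of $\mathrm{IDR}(R)$ generated by the constants $$1\otimes\big(\varepsilon(f\otimes\tau(W))-\mathrm{E}(f\sigma(W))\big)\otimes1\otimes1_T\qquad\text{and}\qquad1\otimes1\otimes\big(\varepsilon(\tau(U)\odot\tau(V))-\mathrm{E}(\sigma(U)\sigma(V))\big)\otimes1_T$$ for all $f\in R_J$, all words $W$ and all nonempty words $U,V$ over $I$, where the evaluations are taken in $S$ and lie in $C$ by (1). Since $J$ is generated by constants, it is closed under $\partial$ and $\int$, so that $\mathrm{IDR}(R)/J$ is an integro-differential ring. Then there is a unique integro-differential ring homomorphism $\tilde\eta\colon\mathrm{IDR}(R)/J\to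 S$ with $\tilde\eta(\iota(f)+J)=f$ for all $f\in R$, and $\tilde\eta$ is an isomorphism of integro-differential rings from $\mathrm{IDR}(R)/J$ onto $\bar R$. -/

import Mathlib

open scoped TensorProduct Differential

noncomputable section

namespace IntegroDiff

section Tensor

variable {K : Type*} {M : Type*} {N : Type*} [CommRing K] [AddCommGroup M] [Module K M]
  [AddCommGroup N] [Module K N]

/-- The pure tensor `f₁ ⊗ ⋯ ⊗ fₙ` in the tensor algebra; the empty list gives the empty tensor `1`. -/
def pureTensor (l : List M) : TensorAlgebra K M := (l.map (TensorAlgebra.ι K)).prod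

@[simp] theorem pureTensor_nil : pureTensor (K := K) ([] : List M) = 1 := rfl

@[simp] theorem pureTensor_cons (a : M) (l : List M) :
    pureTensor (K := K) (a :: l) = TensorAlgebra.ι K a * pureTensor l := by
  simp [pureTensor]

theorem pureTensor_append (l l' : List M) :
    pureTensor (K := K) (l ++ l') = pureTensor l * pureTensor l' := by
  simp [pureTensor]

theorem mem_span_pureTensor (t : TensorAlgebra K M) :
    t ∈ Submodule.span K (Set.range (pureTensor (K := K) (M := M))) := by
  induction t using TensorAlgebra.induction with
  | algebraMap r =>
    rw [Algebra.algebraMap_eq_smul_one]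
    exact Submodule.smul_mem _ _ (Submodule.subset_span ⟨[], rfl⟩)
  | ι x => exact Submodule.subset_span ⟨[x], by simp⟩
  | mul x y hx hy =>
    have h := Submodule.mul_mem_mul hx hy
    rw [Submodule.span_mul_span] at h
    refine Submodule.span_mono ?_ h
    rintro _ ⟨_, ⟨l, rfl⟩, _, ⟨l', rfl⟩, rfl⟩
    exact ⟨l ++ l', pureTensor_append l l'⟩
  | add x y hx hy => exact Submodule.add_mem _ hx hy

theorem tensor_induction {P : TensorAlgebra K M → Prop} (t : TensorAlgebra K M)
    (pure : ∀ l, P (pureTensor l)) (add : ∀ x y, P x → P y → P (x + y))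
    (smul : ∀ (c : K) x, P x → P (c • x)) : P t := by
  induction mem_span_pureTensor t using Submodule.span_induction with
  | mem x h => obtain ⟨l, rfl⟩ := h; exact pure l
  | zero => simpa using smul 0 _ (pure [])
  | add x y _ _ hx hy => exact add x y hx hy
  | smul c x _ hx => exact smul c x hx

theorem ext_pureTensor {f g : TensorAlgebra K M →ₗ[K] N}
    (h : ∀ l, f (pureTensor l) = g (pureTensor l)) : f = g := by
  ext t
  induction t using tensor_induction with
  | pure l => exact h l
  | add x y hx hy => simp [hx, hy]
  | smul c x hx => simp [hx]

/-- Prepending a vector: `a ↦ (t ↦ a ⊗ t)`. -/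
def prepend : M →ₗ[K] Module.End K (TensorAlgebra K M) :=
  (LinearMap.mul K (TensorAlgebra K M)).comp (TensorAlgebra.ι K)

@[simp] theorem prepend_apply (a : M) (t : TensorAlgebra K M) :
    prepend a t = TensorAlgebra.ι K a * t := rfl

/-- Auxiliary map for `tensorRec`. -/
def tensorRecAux (L : M →ₗ[K] Module.End K N) (G : M →ₗ[K] TensorAlgebra K M →ₗ[K] N) :
    M →ₗ[K] Module.End K (TensorAlgebra K M × N) where
  toFun a := ((prepend a).comp (LinearMap.fst K (TensorAlgebra K M) N)).prod
    ((L a).comp (LinearMap.snd K (TensorAlgebra K M) N) +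
      (G a).comp (LinearMap.fst K (TensorAlgebra K M) N))
  map_add' a b := by
    ext x <;> simp
  map_smul' c a := by
    ext x <;> simp

theorem tensorRecAux_apply (L : M →ₗ[K] Module.End K N) (G : M →ₗ[K] TensorAlgebra K M →ₗ[K] N)
    (a : M) (x : TensorAlgebra K M × N) :
    tensorRecAux L G a x = (TensorAlgebra.ι K a * x.1, L a x.2 + G a x.1) := rfl

/-- Linear recursion on tensors: the linear map `φ` with `φ(1) = n` and
`φ(a ⊗ t) = L a (φ t) + G a t` for vectors `a`. -/
def tensorRec (L : M →ₗ[K] Module.End K N) (n : N) (G : M →ₗ[K] TensorAlgebra K M →ₗ[K] N) :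
    TensorAlgebra K M →ₗ[K] N :=
  (LinearMap.snd K (TensorAlgebra K M) N).comp
    ((LinearMap.applyₗ ((1, n) : TensorAlgebra K M × N)).comp
      (TensorAlgebra.lift K (tensorRecAux L G)).toLinearMap)

@[simp] theorem tensorRec_one (L : M →ₗ[K] Module.End K N) (n : N)
    (G : M →ₗ[K] TensorAlgebra K M →ₗ[K] N) : tensorRec L n G 1 = n := by
  simp [tensorRec]

theorem tensorRec_fst (L : M →ₗ[K] Module.End K N) (n : N)
    (G : M →ₗ[K] TensorAlgebra K M →ₗ[K] N) (t : TensorAlgebra K M) :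
    (TensorAlgebra.lift K (tensorRecAux L G) t (1, n)).1 = t := by
  induction t using tensor_induction with
  | pure l =>
    induction l with
    | nil => simp
    | cons a l ih =>
      simp only [pureTensor_cons, map_mul, TensorAlgebra.lift_ι_apply, Module.End.mul_apply]
      rw [tensorRecAux_apply, ih]
  | add x y hx hy => simp [hx, hy]
  | smul c x hx => simp [hx]

@[simp] theorem tensorRec_ι_mul (L : M →ₗ[K] Module.End K N) (n : N)
    (G : M →ₗ[K] TensorAlgebra K M →ₗ[K] N) (a : M) (t : TensorAlgebra K M) :
    tensorRec L n G (TensorAlgebra.ι K a * t) = L a (tensorRec L n G t) + G a t := by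
  have h := tensorRec_fst L n G t
  simp only [tensorRec, LinearMap.comp_apply, LinearMap.snd_apply, LinearMap.applyₗ_apply_apply,
    AlgHom.toLinearMap_apply, map_mul, TensorAlgebra.lift_ι_apply, Module.End.mul_apply]
  rw [tensorRecAux_apply, h]

/-- `tensorRec` as a linear map of its initial value and its inhomogeneous part. -/
def tensorRecₗ (L : M →ₗ[K] Module.End K N) :
    (N × (M →ₗ[K] TensorAlgebra K M →ₗ[K] N)) →ₗ[K] TensorAlgebra K M →ₗ[K] N where
  toFun p := tensorRec L p.1 p.2
  map_add' p q := by
    change tensorRec L (p.1 + q.1) (p.2 + q.2) = tensorRec L p.1 p.2 + tensorRec L q.1 q.2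
    apply ext_pureTensor
    intro l
    induction l with
    | nil => simp
    | cons a l ih =>
      simp only [pureTensor_cons, tensorRec_ι_mul, ih, LinearMap.add_apply, map_add]
      abel
  map_smul' c p := by
    change tensorRec L (c • p.1) (c • p.2) = c • tensorRec L p.1 p.2
    apply ext_pureTensor
    intro l
    induction l with
    | nil => simp
    | cons a l ih =>
      simp only [pureTensor_cons, tensorRec_ι_mul, ih, LinearMap.smul_apply, map_smul, smul_add]

theorem tensorRecₗ_apply (L : M →ₗ[K] Module.End K N)
    (p : N × (M →ₗ[K] TensorAlgebra K M →ₗ[K] N)) : tensorRecₗ L p = tensorRec L p.1 p.2 := rfl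

/-- For a bilinear map `e`, the map `x ↦ (b ↦ (g ↦ e x (b ⊗ g)))`. -/
def precompPrepend {X : Type*} [AddCommGroup X] [Module K X]
    (e : X →ₗ[K] TensorAlgebra K M →ₗ[K] N) : X →ₗ[K] M →ₗ[K] TensorAlgebra K M →ₗ[K] N where
  toFun x := (prepend (K := K) (M := M)).compr₂ (e x)
  map_add' _ _ := by ext; simp
  map_smul' _ _ := by ext; simp

@[simp] theorem precompPrepend_apply {X : Type*} [AddCommGroup X] [Module K X]
    (e : X →ₗ[K] TensorAlgebra K M →ₗ[K] N) (x : X) (b : M) (g : TensorAlgebra K M) :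
    precompPrepend e x b g = e x (TensorAlgebra.ι K b * g) := rfl

/-- Auxiliary map for `recProd`: it sends `a` and `F` to the linear map `φ` with `φ(1) = 0` and
`φ(b ⊗ g) = L a (F (b ⊗ g)) + L b (φ g)`. -/
def recProdAux (L : M →ₗ[K] Module.End K N) :
    M →ₗ[K] Module.End K (TensorAlgebra K M →ₗ[K] N) where
  toFun a := (tensorRecₗ L).comp ((LinearMap.inr K N _).comp
    (precompPrepend (LinearMap.llcomp K (TensorAlgebra K M) N N (L a))))
  map_add' a b := by
    ext1 F
    simp only [LinearMap.comp_apply, LinearMap.add_apply, ← map_add]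
    congr 2
    ext; simp
  map_smul' c a := by
    ext1 F
    simp only [LinearMap.comp_apply, LinearMap.smul_apply, ← map_smul, RingHom.id_apply]
    congr 2
    ext; simp

/-- The bilinear product on tensors with values in `N` given by the recursion
`1 * g = j g`, `f * 1 = j f`, and
`(a ⊗ f) * (b ⊗ g) = L a (f * (b ⊗ g)) + L b ((a ⊗ f) * g) + e (a ⊗ f) (b ⊗ g)`. -/
def recProd (L : M →ₗ[K] Module.End K N) (j : TensorAlgebra K M →ₗ[K] N)
    (e : TensorAlgebra K M →ₗ[K] TensorAlgebra K M →ₗ[K] N) :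
    TensorAlgebra K M →ₗ[K] TensorAlgebra K M →ₗ[K] N :=
  tensorRec (recProdAux L) j
    ((prepend (K := K) (M := M)).compr₂
      ((tensorRecₗ L).comp (LinearMap.prod j (precompPrepend e))))

variable (L : M →ₗ[K] Module.End K N) (j : TensorAlgebra K M →ₗ[K] N)
  (e : TensorAlgebra K M →ₗ[K] TensorAlgebra K M →ₗ[K] N)

@[simp] theorem recProd_one_left (g : TensorAlgebra K M) : recProd L j e 1 g = j g := by
  simp [recProd]

@[simp] theorem recProd_one_right (f : TensorAlgebra K M) : recProd L j e f 1 = j f := by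
  revert f
  suffices h : (recProd L j e).flip 1 = j from fun f => LinearMap.congr_fun h f
  apply ext_pureTensor
  intro l
  cases l with
  | nil => simp
  | cons a l => simp [recProd, recProdAux, tensorRecₗ_apply]

theorem recProd_mul_mul (a b : M) (f g : TensorAlgebra K M) :
    recProd L j e (TensorAlgebra.ι K a * f) (TensorAlgebra.ι K b * g) =
      L a (recProd L j e f (TensorAlgebra.ι K b * g)) +
      L b (recProd L j e (TensorAlgebra.ι K a * f) g) +
      e (TensorAlgebra.ι K a * f) (TensorAlgebra.ι K b * g) := by
  simp [recProd, recProdAux, tensorRecₗ_apply]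
  abel

/-- The shuffle product on the tensor algebra: `1 ⧢ g = g`, `f ⧢ 1 = f`, and
`(a ⊗ f) ⧢ (b ⊗ g) = a ⊗ (f ⧢ (b ⊗ g)) + b ⊗ ((a ⊗ f) ⧢ g)`. -/
def shuffle : TensorAlgebra K M →ₗ[K] TensorAlgebra K M →ₗ[K] TensorAlgebra K M :=
  recProd prepend LinearMap.id 0

@[simp] theorem shuffle_one_left (g : TensorAlgebra K M) : shuffle 1 g = g := by simp [shuffle]

@[simp] theorem shuffle_one_right (f : TensorAlgebra K M) : shuffle f 1 = f := by simp [shuffle]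

theorem shuffle_mul_mul (a b : M) (f g : TensorAlgebra K M) :
    shuffle (TensorAlgebra.ι K a * f) (TensorAlgebra.ι K b * g) =
      TensorAlgebra.ι K a * shuffle f (TensorAlgebra.ι K b * g) +
      TensorAlgebra.ι K b * shuffle (TensorAlgebra.ι K a * f) g := by
  simp [shuffle, recProd_mul_mul]

end Tensor

section GeneralProduct

variable {K : Type*} {M : Type*} {B : Type*} [CommRing K] [AddCommGroup M] [Module K M]
  [CommRing B] [Algebra K B]

/-- Prepending a vector in the second factor of `B ⊗ T(M)`: `a ↦ (c ⊗ t ↦ c ⊗ (a ⊗ t))`. -/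
def prependB (K M B : Type*) [CommRing K] [AddCommGroup M] [Module K M] [CommRing B]
    [Algebra K B] : M →ₗ[K] Module.End K (B ⊗[K] TensorAlgebra K M) where
  toFun a := (prepend a).lTensor B
  map_add' a b := by rw [map_add, LinearMap.lTensor_add]
  map_smul' c a := by rw [map_smul, LinearMap.lTensor_smul]; rfl

@[simp] theorem prependB_tmul (a : M) (c : B) (t : TensorAlgebra K M) :
    prependB K M B a (c ⊗ₜ t) = c ⊗ₜ (TensorAlgebra.ι K a * t) := rfl

theorem prependB_smul (a : M) (c : B) (x : B ⊗[K] TensorAlgebra K M) :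
    prependB K M B a (c • x) = c • prependB K M B a x := by
  induction x with
  | zero => simp
  | add x y hx hy => simp only [smul_add, map_add, hx, hy]
  | tmul d t => simp [TensorProduct.smul_tmul']

/-- The generalized shuffle product of tensors with values in `B ⊗ T(M)`, for a bilinear map `e`
on tensors with values in `B`. See `genProd_pureTensor` for the explicit formula. -/
def genProd (e : TensorAlgebra K M →ₗ[K] TensorAlgebra K M →ₗ[K] B) :
    TensorAlgebra K M →ₗ[K] TensorAlgebra K M →ₗ[K] B ⊗[K] TensorAlgebra K M :=
  recProd (prependB K M B) (TensorProduct.mk K B (TensorAlgebra K M) 1)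
    (e.compr₂ ((TensorProduct.mk K B (TensorAlgebra K M)).flip 1))

variable (e : TensorAlgebra K M →ₗ[K] TensorAlgebra K M →ₗ[K] B)

@[simp] theorem genProd_one_left (g : TensorAlgebra K M) : genProd e 1 g = 1 ⊗ₜ g := by
  simp [genProd]

@[simp] theorem genProd_one_right (f : TensorAlgebra K M) : genProd e f 1 = 1 ⊗ₜ f := by
  simp [genProd]

theorem genProd_mul_mul (a b : M) (f g : TensorAlgebra K M) :
    genProd e (TensorAlgebra.ι K a * f) (TensorAlgebra.ι K b * g) =
      prependB K M B a (genProd e f (TensorAlgebra.ι K b * g)) +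
      prependB K M B b (genProd e (TensorAlgebra.ι K a * f) g) +
      e (TensorAlgebra.ι K a * f) (TensorAlgebra.ι K b * g) ⊗ₜ 1 := by
  simp [genProd, recProd_mul_mul]

/-- The explicit formula for the generalized shuffle product of pure tensors: the shuffle product
plus all terms in which a pair of nonempty end segments is replaced by its value under `e`. -/
theorem genProd_pureTensor (f g : List M) :
    genProd e (pureTensor f) (pureTensor g) =
      1 ⊗ₜ shuffle (pureTensor f) (pureTensor g) +
      ∑ i ∈ Finset.range f.length, ∑ j ∈ Finset.range g.length,
        e (pureTensor (f.drop i)) (pureTensor (g.drop j)) ⊗ₜ[K]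
          shuffle (pureTensor (f.take i)) (pureTensor (g.take j)) := by
  induction f generalizing g with
  | nil => simp
  | cons a f ihf =>
    induction g with
    | nil => simp
    | cons b g ihg =>
      have h1 := ihf (b :: g)
      simp only [pureTensor_cons] at h1 ihg
      rw [pureTensor_cons, pureTensor_cons, genProd_mul_mul, h1, ihg, shuffle_mul_mul]
      simp only [List.length_cons]
      simp only [map_add, map_sum, prependB_tmul, TensorProduct.tmul_add]
      simp only [Finset.sum_range_succ', List.drop_succ_cons, List.take_succ_cons,
        List.drop_zero, List.take_zero, pureTensor_cons, pureTensor_nil, shuffle_one_left,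
        shuffle_one_right, shuffle_mul_mul, TensorProduct.tmul_add, Finset.sum_add_distrib]
      abel

theorem genProd_comm (he : ∀ f g, e f g = e g f) (f g : TensorAlgebra K M) :
    genProd e f g = genProd e g f := by
  suffices h : genProd e = (genProd e).flip by
    exact LinearMap.congr_fun (LinearMap.congr_fun h f) g
  apply ext_pureTensor
  intro f
  apply ext_pureTensor
  intro g
  change genProd e (pureTensor f) (pureTensor g) = genProd e (pureTensor g) (pureTensor f)
  induction f generalizing g with
  | nil => simp
  | cons a f ihf =>
    induction g with
    | nil => simp
    | cons b g ihg =>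
      have h1 := ihf (b :: g)
      simp only [pureTensor_cons] at h1 ihg ⊢
      rw [genProd_mul_mul, genProd_mul_mul, h1, ihg, he]
      abel

/-- The extension of `genProd` to a `B`-bilinear product on `B ⊗ T(M)`:
`(c ⊗ f) * (d ⊗ g) = c d (f * g)`. -/
def genMul : B ⊗[K] TensorAlgebra K M →ₗ[B] B ⊗[K] TensorAlgebra K M →ₗ[B]
    B ⊗[K] TensorAlgebra K M :=
  LinearMap.liftBaseChange B
    (((LinearMap.liftBaseChangeEquiv (R := K) (M := TensorAlgebra K M)
      (N := B ⊗[K] TensorAlgebra K M) B).toLinearMap.restrictScalars K).comp (genProd e))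

@[simp] theorem genMul_tmul_tmul (c d : B) (f g : TensorAlgebra K M) :
    genMul e (c ⊗ₜ f) (d ⊗ₜ g) = (c * d) • genProd e f g := by
  simp [genMul, mul_smul]

theorem genMul_comm (he : ∀ f g, e f g = e g f) (x y : B ⊗[K] TensorAlgebra K M) :
    genMul e x y = genMul e y x := by
  induction x with
  | zero => simp
  | add x x' hx hx' => simp [hx, hx']
  | tmul c f =>
    induction y with
    | zero => simp
    | add y y' hy hy' => simp [hy, hy']
    | tmul d g => rw [genMul_tmul_tmul, genMul_tmul_tmul, genProd_comm e he, mul_comm]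

theorem genMul_one_left (x : B ⊗[K] TensorAlgebra K M) : genMul e (1 ⊗ₜ 1) x = x := by
  induction x with
  | zero => simp
  | add x x' hx hx' => simp [hx, hx']
  | tmul c f => simp [TensorProduct.smul_tmul']

/-- The `B`-linear extension of `e` in the first argument. -/
def extE (h : TensorAlgebra K M) : B ⊗[K] TensorAlgebra K M →ₗ[B] B :=
  LinearMap.liftBaseChange B (e.flip h)

@[simp] theorem extE_tmul (h : TensorAlgebra K M) (c : B) (f : TensorAlgebra K M) :
    extE e h (c ⊗ₜ f) = c * e f h := by simp [extE]

theorem genMul_prependB (a c : M) (P : B ⊗[K] TensorAlgebra K M) (h : TensorAlgebra K M) :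
    genMul e (prependB K M B a P) (1 ⊗ₜ (TensorAlgebra.ι K c * h)) =
      prependB K M B a (genMul e P (1 ⊗ₜ (TensorAlgebra.ι K c * h))) +
      prependB K M B c (genMul e (prependB K M B a P) (1 ⊗ₜ h)) +
      extE e (TensorAlgebra.ι K c * h) (prependB K M B a P) ⊗ₜ 1 := by
  induction P with
  | zero => simp
  | add x x' hx hx' =>
    simp only [map_add, LinearMap.add_apply, hx, hx', TensorProduct.add_tmul]
    abel
  | tmul d f =>
    simp only [prependB_tmul, genMul_tmul_tmul, extE_tmul, mul_one, genProd_mul_mul, smul_add,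
      prependB_smul, TensorProduct.smul_tmul', smul_eq_mul]

theorem genMul_genProd_cons (he1 : ∀ g, e 1 g = 0) (a b c : M) (f g h : TensorAlgebra K M) :
    genMul e (genProd e (TensorAlgebra.ι K a * f) (TensorAlgebra.ι K b * g))
        (1 ⊗ₜ (TensorAlgebra.ι K c * h)) =
      prependB K M B a (genMul e (genProd e f (TensorAlgebra.ι K b * g))
        (1 ⊗ₜ (TensorAlgebra.ι K c * h))) +
      prependB K M B b (genMul e (genProd e (TensorAlgebra.ι K a * f) g)
        (1 ⊗ₜ (TensorAlgebra.ι K c * h))) +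
      prependB K M B c (genMul e
        (genProd e (TensorAlgebra.ι K a * f) (TensorAlgebra.ι K b * g)) (1 ⊗ₜ h)) +
      extE e (TensorAlgebra.ι K c * h)
        (genProd e (TensorAlgebra.ι K a * f) (TensorAlgebra.ι K b * g)) ⊗ₜ 1 := by
  rw [genProd_mul_mul]
  simp only [map_add, LinearMap.add_apply, genMul_prependB, TensorProduct.add_tmul]
  simp only [genMul_tmul_tmul, extE_tmul, genProd_one_left, he1, mul_zero, mul_one,
    TensorProduct.zero_tmul, add_zero, prependB_smul, prependB_tmul]
  abel

theorem genMul_assoc_pure (he : ∀ f g, e f g = e g f) (he1 : ∀ g, e 1 g = 0)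
    (heA : ∀ f g h : List M, f ≠ [] → g ≠ [] → h ≠ [] →
      extE e (pureTensor h) (genProd e (pureTensor f) (pureTensor g)) =
        extE e (pureTensor f) (genProd e (pureTensor g) (pureTensor h)))
    (f g h : List M) :
    genMul e (genProd e (pureTensor f) (pureTensor g)) (1 ⊗ₜ pureTensor h) =
      genMul e (genProd e (pureTensor g) (pureTensor h)) (1 ⊗ₜ pureTensor f) := by
  induction f generalizing g h with
  | nil =>
    rw [pureTensor_nil, genProd_one_left, genMul_comm e he _ (1 ⊗ₜ 1), genMul_one_left]
    simp
  | cons a f ihf =>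
    induction g generalizing h with
    | nil => simp [genProd_comm e he]
    | cons b g ihg =>
      induction h with
      | nil =>
        rw [pureTensor_nil, genProd_one_right, genMul_comm e he _ (1 ⊗ₜ 1), genMul_one_left]
        simp [genProd_comm e he]
      | cons c h ihh =>
        have hA := heA (a :: f) (b :: g) (c :: h) (by simp) (by simp) (by simp)
        have h1 := ihf (b :: g) (c :: h)
        have h2 := ihg (c :: h)
        simp only [pureTensor_cons] at hA h1 h2 ihh ⊢
        rw [genMul_genProd_cons e he1, genMul_genProd_cons e he1, hA, h1, h2, ihh]
        abel

theorem genMul_assoc (he : ∀ f g, e f g = e g f) (he1 : ∀ g, e 1 g = 0)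
    (heA : ∀ f g h : List M, f ≠ [] → g ≠ [] → h ≠ [] →
      extE e (pureTensor h) (genProd e (pureTensor f) (pureTensor g)) =
        extE e (pureTensor f) (genProd e (pureTensor g) (pureTensor h)))
    (x y z : B ⊗[K] TensorAlgebra K M) :
    genMul e (genMul e x y) z = genMul e x (genMul e y z) := by
  have key : ∀ f g h : TensorAlgebra K M,
      genMul e (genProd e f g) (1 ⊗ₜ h) = genMul e (genProd e g h) (1 ⊗ₜ f) := by
    intro f g h
    induction f using tensor_induction with
    | add f f' hf hf' =>
      simp only [map_add, LinearMap.add_apply, TensorProduct.tmul_add, hf, hf']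
    | smul c f hf =>
      rw [map_smul, LinearMap.smul_apply, TensorProduct.tmul_smul, ← algebraMap_smul B c,
        ← algebraMap_smul B c (1 ⊗ₜ[K] f), map_smul, map_smul, LinearMap.smul_apply, hf]
    | pure f =>
      induction g using tensor_induction with
      | add f f' hf hf' =>
        simp only [map_add, LinearMap.add_apply, hf, hf']
      | smul c g hg =>
        rw [map_smul (genProd e (pureTensor f)), map_smul (genProd e), LinearMap.smul_apply,
          ← algebraMap_smul B c, ← algebraMap_smul B c (genProd e g h), map_smul, map_smul,
          LinearMap.smul_apply, LinearMap.smul_apply, hg]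
      | pure g =>
        induction h using tensor_induction with
        | add f f' hf hf' =>
          simp only [map_add, LinearMap.add_apply, TensorProduct.tmul_add, hf, hf']
        | smul c h hh =>
          rw [map_smul, TensorProduct.tmul_smul, ← algebraMap_smul B c,
            ← algebraMap_smul B c (genProd e _ h), map_smul, map_smul, LinearMap.smul_apply, hh]
        | pure h => exact genMul_assoc_pure e he he1 heA f g h
  induction x with
  | zero => simp
  | add x x' hx hx' => simp only [map_add, LinearMap.add_apply, hx, hx']
  | tmul c f =>
    induction y with
    | zero => simp
    | add x x' hx hx' => simp only [map_add, LinearMap.add_apply, hx, hx']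
    | tmul d g =>
      induction z with
      | zero => simp
      | add x x' hx hx' => simp only [map_add, hx, hx']
      | tmul b h =>
        have hs : ∀ (c : B) (f : TensorAlgebra K M), c ⊗ₜ[K] f = c • (1 ⊗ₜ[K] f) := by
          intro c f; simp [TensorProduct.smul_tmul']
        rw [genMul_tmul_tmul, genMul_tmul_tmul, hs b h, hs c f]
        simp only [map_smul, LinearMap.smul_apply]
        rw [key, genMul_comm e he (1 ⊗ₜ f)]
        simp only [smul_smul]
        congr 1
        ring

/-- The module `B ⊗ T(M)`, without the multiplication of a tensor product of algebras. -/
def TensorModule (K M B : Type*) [CommRing K] [AddCommGroup M] [Module K M]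
    [CommRing B] [Algebra K B] : Type _ := B ⊗[K] TensorAlgebra K M

instance : AddCommGroup (TensorModule K M B) :=
  inferInstanceAs (AddCommGroup (B ⊗[K] TensorAlgebra K M))

/-- `B ⊗ T(M)` as a commutative ring under `genMul`. -/
def genCommRing (he : ∀ f g, e f g = e g f) (he1 : ∀ g, e 1 g = 0)
    (heA : ∀ f g h : List M, f ≠ [] → g ≠ [] → h ≠ [] →
      extE e (pureTensor h) (genProd e (pureTensor f) (pureTensor g)) =
        extE e (pureTensor f) (genProd e (pureTensor g) (pureTensor h))) :
    CommRing (TensorModule K M B) :=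
  { (inferInstance : AddCommGroup (TensorModule K M B)) with
    mul := fun x y => genMul e x y
    one := (1 ⊗ₜ[K] 1 : B ⊗[K] TensorAlgebra K M)
    mul_assoc := genMul_assoc e he he1 heA
    mul_comm := genMul_comm e he
    one_mul := genMul_one_left e
    mul_one := fun x => (genMul_comm e he x _).trans (genMul_one_left e x)
    left_distrib := fun x y z => map_add (genMul e x) y z
    right_distrib := fun x y z => by
      change genMul e (x + y) z = genMul e x z + genMul e y z
      exact (LinearMap.congr_fun (map_add (genMul e) x y) z)
    zero_mul := fun x => LinearMap.congr_fun (map_zero (genMul e)) x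
    mul_zero := fun x => map_zero (genMul e x) }

end GeneralProduct

section ShuffleAlgebra

variable (K : Type*) (M : Type*) [CommRing K] [AddCommGroup M] [Module K M]

/-- The submodule `⨁_{n ≥ 1} M^{⊗n}` of the tensor algebra, i.e. the kernel of the projection of
`T(M)` onto its component `K` of degree zero. -/
def positiveTensors : Submodule K (TensorAlgebra K M) :=
  LinearMap.ker (TensorAlgebra.algebraMapInv (R := K) (M := M)).toLinearMap

/-- The projection of `T(M)` onto `⨁_{n ≥ 1} M^{⊗n}` along the component of degree zero. -/
def positivePart : TensorAlgebra K M →ₗ[K] positiveTensors K M :=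
  LinearMap.codRestrict _
    (LinearMap.id - (Algebra.linearMap K (TensorAlgebra K M)).comp
      (TensorAlgebra.algebraMapInv (R := K) (M := M)).toLinearMap)
    (fun t => by
      simp [positiveTensors, TensorAlgebra.algebraMap_leftInverse M _])

/-- The symmetric product of a module with itself. -/
def SymSquare (P : Type*) [AddCommGroup P] [Module K P] : Type _ :=
  (P ⊗[K] P) ⧸ Submodule.span K (Set.range fun p : P × P => p.1 ⊗ₜ[K] p.2 - p.2 ⊗ₜ[K] p.1)

section SymSquare

variable (P : Type*) [AddCommGroup P] [Module K P]

instance : AddCommGroup (SymSquare K P) :=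
  inferInstanceAs (AddCommGroup ((P ⊗[K] P) ⧸ Submodule.span K
    (Set.range fun p : P × P => p.1 ⊗ₜ[K] p.2 - p.2 ⊗ₜ[K] p.1)))

instance : Module K (SymSquare K P) :=
  inferInstanceAs (Module K ((P ⊗[K] P) ⧸ Submodule.span K
    (Set.range fun p : P × P => p.1 ⊗ₜ[K] p.2 - p.2 ⊗ₜ[K] p.1)))

/-- The symmetric product `f ⊙ g`. -/
def symMul : P →ₗ[K] P →ₗ[K] SymSquare K P :=
  (TensorProduct.mk K P P).compr₂ (Submodule.mkQ _)

theorem symMul_comm (f g : P) : symMul K P f g = symMul K P g f := by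
  refine (Submodule.Quotient.eq _).mpr ?_
  exact Submodule.subset_span ⟨(f, g), rfl⟩

end SymSquare

/-- The symmetric algebra on the symmetric product of `⨁_{n ≥ 1} M^{⊗n}` with itself. -/
def SymConstants : Type _ := SymmetricAlgebra K (SymSquare K (positiveTensors K M))

instance : CommRing (SymConstants K M) :=
  inferInstanceAs (CommRing (SymmetricAlgebra K (SymSquare K (positiveTensors K M))))

instance : Algebra K (SymConstants K M) :=
  inferInstanceAs (Algebra K (SymmetricAlgebra K (SymSquare K (positiveTensors K M))))

/-- The canonical inclusion of the symmetric product into its symmetric algebra. -/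
def symConstantsι : SymSquare K (positiveTensors K M) →ₗ[K] SymConstants K M :=
  SymmetricAlgebra.ι K (SymSquare K (positiveTensors K M))

/-- The generator `ε(f ⊙ g)` of `SymConstants K M`, for `f` and `g` in `⨁_{n ≥ 1} M^{⊗n}`. It is
extended bilinearly to all tensors by zero on tensors of degree zero. -/
def symEps : TensorAlgebra K M →ₗ[K] TensorAlgebra K M →ₗ[K] SymConstants K M :=
  ((symMul K (positiveTensors K M)).compr₂ (symConstantsι K M)).compl₁₂
    (positivePart K M) (positivePart K M)

variable {M} in
/-- The relation imposed on the generators `ε(f ⊙ g)`, for pure tensors `f`, `g`, `h`. -/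
def constRel (f g h : List M) : SymConstants K M :=
  symEps K M (shuffle (pureTensor f) (pureTensor g)) (pureTensor h)
    - symEps K M (pureTensor f) (shuffle (pureTensor g) (pureTensor h))
    + ∑ j ∈ Finset.range g.length,
      (∑ i ∈ Finset.Ico (1 - j) f.length,
          symEps K M (pureTensor (f.drop i)) (pureTensor (g.drop j)) *
            symEps K M (shuffle (pureTensor (f.take i)) (pureTensor (g.take j))) (pureTensor h)
        - ∑ k ∈ Finset.Ico (1 - j) h.length,
          symEps K M (pureTensor f) (shuffle (pureTensor (g.take j)) (pureTensor (h.take k))) *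
            symEps K M (pureTensor (g.drop j)) (pureTensor (h.drop k)))

/-- The ideal generated by the relations `constRel` for pure tensors of positive length. -/
def constRelIdeal : Ideal (SymConstants K M) :=
  Ideal.span {x | ∃ f g h : List M, f ≠ [] ∧ g ≠ [] ∧ h ≠ [] ∧ x = constRel K f g h}

/-- The algebra `C₂` of constants arising as evaluations of products of two nested integrals. -/
def ProductConstants : Type _ := SymConstants K M ⧸ constRelIdeal K M

instance : CommRing (ProductConstants K M) :=
  inferInstanceAs (CommRing (SymConstants K M ⧸ constRelIdeal K M))

instance : Algebra K (ProductConstants K M) :=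
  inferInstanceAs (Algebra K (SymConstants K M ⧸ constRelIdeal K M))

/-- The quotient map onto `C₂`. -/
def productConstantsMk : SymConstants K M →ₐ[K] ProductConstants K M :=
  Ideal.Quotient.mkₐ K (constRelIdeal K M)

/-- The element `ε(f ⊙ g)` of `C₂`, for `f` and `g` in `⨁_{n ≥ 1} M^{⊗n}`
(and zero if `f` or `g` is of degree zero). -/
def productEps : TensorAlgebra K M →ₗ[K] TensorAlgebra K M →ₗ[K] ProductConstants K M :=
  (symEps K M).compr₂ (productConstantsMk K M).toLinearMap

theorem positivePart_one : positivePart K M 1 = 0 := by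
  apply Subtype.ext
  change (1 : TensorAlgebra K M) - algebraMap K _ (TensorAlgebra.algebraMapInv 1) = 0
  rw [map_one, map_one, sub_self]

theorem symEps_one_left (g : TensorAlgebra K M) : symEps K M 1 g = 0 := by
  simp [symEps, positivePart_one]

theorem symEps_one_right (g : TensorAlgebra K M) : symEps K M g 1 = 0 := by
  simp [symEps, positivePart_one]

theorem symEps_comm (f g : TensorAlgebra K M) : symEps K M f g = symEps K M g f := by
  simp only [symEps, LinearMap.compl₁₂_apply, LinearMap.compr₂_apply]
  rw [symMul_comm]

theorem productEps_apply (f g : TensorAlgebra K M) :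
    productEps K M f g = productConstantsMk K M (symEps K M f g) := rfl

theorem productEps_one_left (g : TensorAlgebra K M) : productEps K M 1 g = 0 := by
  rw [productEps_apply, symEps_one_left, map_zero]

theorem productEps_comm (f g : TensorAlgebra K M) : productEps K M f g = productEps K M g f := by
  rw [productEps_apply, symEps_comm, productEps_apply]

theorem sum_Ico_one_sub {A : Type*} [AddCommMonoid A] (n j : ℕ) (F : ℕ → A)
    (h : j = 0 → F 0 = 0) :
    ∑ i ∈ Finset.Ico (1 - j) n, F i = ∑ i ∈ Finset.range n, F i := by
  refine Finset.sum_subset (fun i hi => by simp at hi ⊢; omega) (fun i hi hi' => ?_)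
  simp at hi hi'
  have : i = 0 ∧ j = 0 := by omega
  rw [this.1]; exact h this.2

theorem productEps_assoc (f g h : List M) (hf : f ≠ []) (hg : g ≠ []) (hh : h ≠ []) :
    extE (productEps K M) (pureTensor h) (genProd (productEps K M) (pureTensor f) (pureTensor g)) =
      extE (productEps K M) (pureTensor f)
        (genProd (productEps K M) (pureTensor g) (pureTensor h)) := by
  have hrel : productConstantsMk K M (constRel K f g h) = 0 :=
    Ideal.Quotient.eq_zero_iff_mem.mpr (Ideal.subset_span ⟨f, g, h, hf, hg, hh, rfl⟩)
  rw [← sub_eq_zero, ← hrel, genProd_pureTensor, genProd_pureTensor, constRel]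
  simp only [map_add, map_sub, map_sum, map_mul, extE_tmul, one_mul, ← productEps_apply]
  rw [Finset.sum_comm, Finset.sum_sub_distrib]
  have h1 : ∀ j, (∑ i ∈ Finset.Ico (1 - j) f.length,
          productEps K M (pureTensor (f.drop i)) (pureTensor (g.drop j)) *
            productEps K M (shuffle (pureTensor (f.take i)) (pureTensor (g.take j)))
              (pureTensor h)) = ∑ i ∈ Finset.range f.length,
          productEps K M (pureTensor (f.drop i)) (pureTensor (g.drop j)) *
            productEps K M (shuffle (pureTensor (f.take i)) (pureTensor (g.take j)))
              (pureTensor h) := fun j => sum_Ico_one_sub _ _ _ (by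
    rintro rfl; simp [productEps_one_left])
  have h2 : ∀ j, (∑ k ∈ Finset.Ico (1 - j) h.length,
          productEps K M (pureTensor f)
            (shuffle (pureTensor (g.take j)) (pureTensor (h.take k))) *
            productEps K M (pureTensor (g.drop j)) (pureTensor (h.drop k))) =
        ∑ k ∈ Finset.range h.length,
          productEps K M (pureTensor (g.drop j)) (pureTensor (h.drop k)) *
          productEps K M (shuffle (pureTensor (g.take j)) (pureTensor (h.take k)))
            (pureTensor f) := fun j => by
    rw [sum_Ico_one_sub]
    · refine Finset.sum_congr rfl fun k _ => ?_
      rw [mul_comm, productEps_comm K M (pureTensor f)]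
    · rintro rfl
      simp [productEps_comm K M _ 1, productEps_one_left]
  simp only [h1, h2]
  rw [productEps_comm K M (pureTensor f)]
  abel

/-- The `K`-module `C₂ ⊗ T(M)`, which carries the generalized shuffle product as multiplication. -/
def ShuffleAlgebra : Type _ := TensorModule K M (ProductConstants K M)

instance : CommRing (ShuffleAlgebra K M) :=
  genCommRing (productEps K M) (productEps_comm K M) (productEps_one_left K M)
    (productEps_assoc K M)

namespace ShuffleAlgebra

variable {K M}

/-- The element `c ⊗ f`. -/
def tmul (c : ProductConstants K M) (f : TensorAlgebra K M) : ShuffleAlgebra K M :=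
  (c ⊗ₜ[K] f : ProductConstants K M ⊗[K] TensorAlgebra K M)

theorem mul_def (x y : ShuffleAlgebra K M) : x * y = genMul (productEps K M) x y := rfl

theorem one_def : (1 : ShuffleAlgebra K M) = tmul 1 1 := rfl

/-- The underlying element of the tensor product. -/
def toTensor (x : ShuffleAlgebra K M) : ProductConstants K M ⊗[K] TensorAlgebra K M := x

/-- The element of `ShuffleAlgebra K M` with a given underlying element of the tensor product. -/
def ofTensor (x : ProductConstants K M ⊗[K] TensorAlgebra K M) : ShuffleAlgebra K M := x

theorem tmul_one_mul (c : ProductConstants K M) (x : ShuffleAlgebra K M) :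
    tmul c 1 * x = ofTensor (c • toTensor x) := by
  have h : (c ⊗ₜ[K] 1 : ProductConstants K M ⊗[K] TensorAlgebra K M) = c • (1 ⊗ₜ[K] 1) := by
    rw [TensorProduct.smul_tmul', smul_eq_mul, mul_one]
  change genMul (productEps K M) (c ⊗ₜ[K] 1) (toTensor x) = c • toTensor x
  rw [h, map_smul, LinearMap.smul_apply, genMul_one_left]

theorem tmul_mul_tmul_one (c d : ProductConstants K M) :
    tmul (M := M) (c * d) 1 = tmul c 1 * tmul d 1 := by
  rw [tmul_one_mul]
  change (c * d) ⊗ₜ[K] 1 = c • (d ⊗ₜ[K] 1)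
  rw [TensorProduct.smul_tmul', smul_eq_mul]

instance : Algebra (ProductConstants K M) (ShuffleAlgebra K M) where
  smul c x := ofTensor (c • toTensor x)
  algebraMap :=
    { toFun := fun c => tmul c 1
      map_one' := rfl
      map_mul' := tmul_mul_tmul_one
      map_zero' := TensorProduct.zero_tmul _ _
      map_add' := fun _ _ => TensorProduct.add_tmul _ _ _ }
  commutes' _ _ := mul_comm _ _
  smul_def' c x := (tmul_one_mul c x).symm

instance : Algebra K (ShuffleAlgebra K M) where
  smul c x := ofTensor (c • toTensor x)
  algebraMap := (algebraMap (ProductConstants K M) (ShuffleAlgebra K M)).comp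
    (algebraMap K (ProductConstants K M))
  commutes' _ _ := mul_comm _ _
  smul_def' c x := by
    refine Eq.trans ?_ (tmul_one_mul (algebraMap K (ProductConstants K M) c) x).symm
    exact (algebraMap_smul (ProductConstants K M) c (toTensor x)).symm

instance : IsScalarTower K (ProductConstants K M) (ShuffleAlgebra K M) :=
  IsScalarTower.of_algebraMap_eq' rfl

/-- The product of pure tensors: the defining formula of the generalized shuffle product. -/
theorem tmul_mul_tmul (c d : ProductConstants K M) (f g : List M) :
    tmul c (pureTensor f) * tmul d (pureTensor g) =
      tmul (c * d) (shuffle (pureTensor f) (pureTensor g)) +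
      ∑ i ∈ Finset.range f.length, ∑ j ∈ Finset.range g.length,
        tmul (c * d * productEps K M (pureTensor (f.drop i)) (pureTensor (g.drop j)))
          (shuffle (pureTensor (f.take i)) (pureTensor (g.take j))) := by
  change genMul (productEps K M) (c ⊗ₜ pureTensor f) (d ⊗ₜ pureTensor g) = _
  rw [genMul_tmul_tmul, genProd_pureTensor]
  simp only [smul_add, Finset.smul_sum, TensorProduct.smul_tmul', smul_eq_mul, mul_one]
  rfl

theorem smul_tmul (c d : ProductConstants K M) (t : TensorAlgebra K M) :
    c • tmul d t = tmul (c * d) t := rfl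

theorem tmul_add (c : ProductConstants K M) (s t : TensorAlgebra K M) :
    tmul c (s + t) = tmul c s + tmul c t := TensorProduct.tmul_add _ _ _

theorem tmul_smul (c : ProductConstants K M) (k : K) (t : TensorAlgebra K M) :
    tmul c (k • t) = tmul (k • c) t := (TensorProduct.smul_tmul k c t).symm

protected theorem induction {P : ShuffleAlgebra K M → Prop} (x : ShuffleAlgebra K M)
    (tmul : ∀ c t, P (tmul c t)) (add : ∀ x y, P x → P y → P (x + y)) : P x := by
  have h0 : P 0 := by
    have h : P (ShuffleAlgebra.tmul 0 0) := tmul 0 0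
    have h' : ShuffleAlgebra.tmul (0 : ProductConstants K M) (0 : TensorAlgebra K M) = 0 :=
      TensorProduct.zero_tmul _ _
    rwa [h'] at h
  exact TensorProduct.induction_on (motive := fun y => P (ofTensor y)) (toTensor x) h0 tmul add

/-- Prepending a vector to the tensor factor. -/
def prependHom (a : M) : ShuffleAlgebra K M →+ ShuffleAlgebra K M :=
  (prependB K M (ProductConstants K M) a).toAddMonoidHom

theorem prependHom_tmul (a : M) (c : ProductConstants K M) (t : TensorAlgebra K M) :
    prependHom a (tmul c t) = tmul c (TensorAlgebra.ι K a * t) := rfl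

theorem tmul_one_mul_tmul_one (f g : TensorAlgebra K M) :
    tmul 1 f * tmul 1 g = ofTensor (genProd (productEps K M) f g) := by
  change genMul (productEps K M) (1 ⊗ₜ[K] f) (1 ⊗ₜ[K] g) = genProd (productEps K M) f g
  rw [genMul_tmul_tmul, mul_one, one_smul]

theorem tmul_ι_mul_tmul_ι (a b : M) (f g : TensorAlgebra K M) :
    tmul 1 (TensorAlgebra.ι K a * f) * tmul 1 (TensorAlgebra.ι K b * g) =
      prependHom a (tmul 1 f * tmul 1 (TensorAlgebra.ι K b * g)) +
      prependHom b (tmul 1 (TensorAlgebra.ι K a * f) * tmul 1 g) +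
      tmul (productEps K M (TensorAlgebra.ι K a * f) (TensorAlgebra.ι K b * g)) 1 := by
  rw [tmul_one_mul_tmul_one, tmul_one_mul_tmul_one, tmul_one_mul_tmul_one, genProd_mul_mul]
  rfl

end ShuffleAlgebra

end ShuffleAlgebra

section Basics

/-- The ring of constants of a differential ring. -/
def constants (A : Type*) [CommRing A] [Differential A] : Subring A where
  carrier := {c | c′ = 0}
  mul_mem' {a b} ha hb := by
    simp only [Set.mem_ofPred_eq] at ha hb ⊢
    simp [ha, hb]
  one_mem' := by simp
  add_mem' {a b} ha hb := by
    simp only [Set.mem_ofPred_eq] at ha hb ⊢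
    simp [ha, hb]
  zero_mem' := by simp
  neg_mem' {a} ha := by
    simp only [Set.mem_ofPred_eq] at ha ⊢
    simp [ha]

theorem mem_constants {A : Type*} [CommRing A] [Differential A] {c : A} :
    c ∈ constants A ↔ c′ = 0 := Iff.rfl

theorem deriv_coe {A : Type*} [CommRing A] [Differential A] (c : constants A) :
    (c : A)′ = 0 := c.2

/-- The derivation of a differential ring as a map that is linear over the constants. -/
def derivₗ (A : Type*) [CommRing A] [Differential A] : A →ₗ[constants A] A where
  toFun f := (f′)
  map_add' := map_add _
  map_smul' c f := by
    change ((c : A) * f)′ = (c : A) * (f′)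
    simp [deriv_coe]

@[simp] theorem derivₗ_apply {A : Type*} [CommRing A] [Differential A] (f : A) :
    derivₗ A f = (f′) := rfl

/-- A commutative integro-differential ring: a commutative differential ring with a right inverse
of the derivation that is linear over the constants. -/
class Integration (A : Type*) [CommRing A] [Differential A] where
  /-- The integration. -/
  int : A →ₗ[constants A] A
  deriv_int : ∀ f : A, (int f)′ = f

/-- The integration of an integro-differential ring. -/
def int {A : Type*} [CommRing A] [Differential A] [Integration A] (f : A) : A :=
  Integration.int f

/-- The induced evaluation `E f = f - ∫ f′` of an integro-differential ring. -/
def eval {A : Type*} [CommRing A] [Differential A] [Integration A] (f : A) : A :=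
  f - int f′

section

variable {A : Type*} [CommRing A] [Differential A] [Integration A]

theorem deriv_int (f : A) : (int f)′ = f := Integration.deriv_int f

theorem int_add (f g : A) : int (f + g) = int f + int g := map_add (Integration.int (A := A)) f g

theorem int_zero : int (0 : A) = 0 := map_zero (Integration.int (A := A))

theorem int_const_mul {c : A} (hc : c′ = 0) (f : A) : int (c * f) = c * int f :=
  (Integration.int (A := A)).map_smul (⟨c, hc⟩ : constants A) f

theorem deriv_eval (f : A) : (eval f)′ = 0 := by
  rw [eval, map_sub, deriv_int, sub_self]

/-- Constructor for `Integration` from an additive map. -/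
@[reducible] def Integration.ofAdd {A : Type*} [CommRing A] [Differential A] (I : A → A)
    (hadd : ∀ f g, I (f + g) = I f + I g) (hmul : ∀ c f : A, c′ = 0 → I (c * f) = c * I f)
    (hI : ∀ f, (I f)′ = f) : Integration A where
  int :=
    { toFun := I
      map_add' := hadd
      map_smul' := fun c f => hmul c f c.2 }
  deriv_int := hI

end

/-- A ring homomorphism between integro-differential rings is an integro-differential ring
homomorphism if it commutes with the derivations and with the integrations. -/
def IsIntegroDiffHom {A B : Type*} [CommRing A] [Differential A] [Integration A]
    [CommRing B] [Differential B] [Integration B] (f : A →+* B) : Prop :=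
  (∀ x, f x′ = (f x)′) ∧ ∀ x, f (int x) = int (f x)

/-- The differential ideal generated by an element: the ideal generated by the element and all its
higher derivatives. -/
def differentialIdeal {A : Type*} [CommRing A] [Differential A] (f : A) : Ideal A :=
  Ideal.span (Set.range fun n : ℕ => (fun g : A => g′)^[n] f)

/-- A quasi-integration on a differential ring: a map `Q`, linear over the constants, with
`∂ Q ∂ = ∂` and `Q ∂ Q = Q`. -/
structure QuasiIntegration (R : Type*) [CommRing R] [Differential R] where
  /-- The underlying linear map. -/
  Q : R →ₗ[constants R] R
  deriv_Q_deriv : ∀ f : R, (Q (f′))′ = (f′)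
  Q_deriv_Q : ∀ f : R, Q (Q f)′ = Q f

namespace QuasiIntegration

variable {R : Type*} [CommRing R] [Differential R] (q : QuasiIntegration R)

/-- The complement `R_J = Q R` of the constants. -/
def RJ : Submodule (constants R) R := LinearMap.range q.Q

/-- The complement `R_T = ker Q` of the module of derivatives. -/
def RT : Submodule (constants R) R := LinearMap.ker q.Q

/-- `Q` as a map onto `R_J`. -/
def toRJ : R →ₗ[constants R] q.RJ := q.Q.rangeRestrict

/-- The projection `f ↦ f - ∂ Q f` onto `R_T`. -/
def toRT : R →ₗ[constants R] q.RT :=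
  LinearMap.codRestrict _ (LinearMap.id - (derivₗ R).comp q.Q) (fun f => by
    simp [RT, q.Q_deriv_Q])

@[simp] theorem coe_toRJ (f : R) : (q.toRJ f : R) = q.Q f := rfl

@[simp] theorem coe_toRT (f : R) : (q.toRT f : R) = f - (q.Q f)′ := rfl

theorem toRT_deriv (f : R) : q.toRT f′ = 0 := by
  ext; simp [q.deriv_Q_deriv]

theorem Q_coe (a : q.RT) : q.Q a = 0 := a.2

theorem toRJ_coe (a : q.RT) : q.toRJ (a : R) = 0 := by
  ext; simp [q.Q_coe]

theorem toRT_coe (a : q.RT) : q.toRT (a : R) = a := by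
  ext; simp [q.Q_coe]

end QuasiIntegration

end Basics

section FreeIntegroDifferentialRing

theorem tmul_eq_mul {K A B C : Type*} [CommRing K] [CommRing A] [Algebra K A] [CommRing B]
    [Algebra K B] [CommRing C] [Algebra K C] (r : A) (c : B) (y : C) :
    (r ⊗ₜ[K] (c ⊗ₜ[K] y) : A ⊗[K] (B ⊗[K] C)) =
      (r ⊗ₜ 1) * (1 ⊗ₜ (c ⊗ₜ 1)) * (1 ⊗ₜ (1 ⊗ₜ y)) := by
  simp

/-- The linear extension to `C ⊗ P` of a linear map `h` on `P` with values in a `C`-algebra: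
`c ⊗ p ↦ κ(c) h(p)`. -/
def mulLift {K C P W : Type*} [CommRing K] [AddCommGroup C] [Module K C] [AddCommGroup P]
    [Module K P] [CommRing W] [Algebra K W] (κ : C →ₗ[K] W) :
    (P →ₗ[K] W) →ₗ[K] C ⊗[K] P →ₗ[K] W :=
  (TensorProduct.lift.equiv (RingHom.id K) C P W).toLinearMap.comp
    ((LinearMap.llcomp K P W W).comp ((LinearMap.mul K W).comp κ)).flip

@[simp] theorem mulLift_tmul {K C P W : Type*} [CommRing K] [AddCommGroup C] [Module K C]
    [AddCommGroup P] [Module K P] [CommRing W] [Algebra K W] (κ : C →ₗ[K] W) (h : P →ₗ[K] W)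
    (c : C) (p : P) : mulLift κ h (c ⊗ₜ p) = κ c * h p := rfl

variable {R : Type*} [CommRing R] [Differential R] (q : QuasiIntegration R)

/-- The algebra `C₁ = Sym(R_J ⊗ T(R_T))` of constants arising as evaluations of products of an
element of `R_J` and a nested integral. -/
def EvalConstants : Type _ :=
  SymmetricAlgebra (constants R) (q.RJ ⊗[constants R] TensorAlgebra (constants R) q.RT)

instance : CommRing (EvalConstants q) :=
  inferInstanceAs (CommRing
    (SymmetricAlgebra (constants R) (q.RJ ⊗[constants R] TensorAlgebra (constants R) q.RT)))

instance : Algebra (constants R) (EvalConstants q) :=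
  inferInstanceAs (Algebra (constants R)
    (SymmetricAlgebra (constants R) (q.RJ ⊗[constants R] TensorAlgebra (constants R) q.RT)))

/-- The generator `ε(f ⊗ t)` of `C₁`. -/
def evalEps : q.RJ →ₗ[constants R] TensorAlgebra (constants R) q.RT →ₗ[constants R]
    EvalConstants q :=
  (TensorProduct.mk (constants R) q.RJ (TensorAlgebra (constants R) q.RT)).compr₂
    (SymmetricAlgebra.ι (constants R) (q.RJ ⊗[constants R] TensorAlgebra (constants R) q.RT))

/-- The free commutative integro-differential ring
`IDR(R) = R ⊗ C₁ ⊗ (C₂ ⊗ T(R_T))`, a tensor product of commutative algebras over the constants. -/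
def IDR : Type _ :=
  R ⊗[constants R] (EvalConstants q ⊗[constants R] ShuffleAlgebra (constants R) q.RT)

namespace IDR

instance : CommRing (IDR q) :=
  inferInstanceAs (CommRing
    (R ⊗[constants R] (EvalConstants q ⊗[constants R] ShuffleAlgebra (constants R) q.RT)))

instance : Algebra (constants R) (IDR q) :=
  inferInstanceAs (Algebra (constants R)
    (R ⊗[constants R] (EvalConstants q ⊗[constants R] ShuffleAlgebra (constants R) q.RT)))

/-- The embedding `ι(f) = f ⊗ 1 ⊗ 1 ⊗ 1`. -/
def ι : R →ₐ[constants R] IDR q :=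
  Algebra.TensorProduct.includeLeft (S := constants R)

/-- The inclusion `c ↦ 1 ⊗ c ⊗ 1 ⊗ 1` of `C₁`. -/
def ofEval : EvalConstants q →ₐ[constants R] IDR q :=
  (Algebra.TensorProduct.includeRight (R := constants R) (A := R)).comp
    (Algebra.TensorProduct.includeLeft (S := constants R)
      (B := ShuffleAlgebra (constants R) q.RT))

/-- The inclusion `x ↦ 1 ⊗ 1 ⊗ x` of `C₂ ⊗ T(R_T)`. -/
def ofShuffle : ShuffleAlgebra (constants R) q.RT →ₐ[constants R] IDR q :=
  (Algebra.TensorProduct.includeRight (R := constants R) (A := R)).comp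
    (Algebra.TensorProduct.includeRight (R := constants R) (A := EvalConstants q))

/-- The inclusion `c ↦ 1 ⊗ 1 ⊗ c ⊗ 1` of `C₂`. -/
def ofProduct : ProductConstants (constants R) q.RT →ₐ[constants R] IDR q :=
  (ofShuffle q).comp (IsScalarTower.toAlgHom (constants R)
    (ProductConstants (constants R) q.RT) (ShuffleAlgebra (constants R) q.RT))

/-- The inclusion `t ↦ 1 ⊗ 1 ⊗ 1 ⊗ t` of tensors. -/
def ofTensor : TensorAlgebra (constants R) q.RT →ₗ[constants R] IDR q :=
  (ofShuffle q).toLinearMap.comp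
    (TensorProduct.mk (constants R) (ProductConstants (constants R) q.RT)
      (TensorAlgebra (constants R) q.RT) 1 : _ →ₗ[constants R] ShuffleAlgebra (constants R) q.RT)

theorem ofShuffle_tmul (c : ProductConstants (constants R) q.RT)
    (t : TensorAlgebra (constants R) q.RT) :
    ofShuffle q (ShuffleAlgebra.tmul c t) = ofProduct q c * ofTensor q t := by
  change _ = ofShuffle q (algebraMap _ _ c) * ofShuffle q (ShuffleAlgebra.tmul 1 t)
  rw [← map_mul, ← Algebra.smul_def]
  congr 1
  change ShuffleAlgebra.tmul c t = ShuffleAlgebra.tmul (c • 1) t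
  rw [smul_eq_mul, mul_one]

theorem ofTensor_one : ofTensor q 1 = 1 := map_one (ofShuffle q)

theorem induction {P : IDR q → Prop} (x : IDR q)
    (h : ∀ r c d l, P (ι q r * ofEval q c * ofProduct q d * ofTensor q (pureTensor l)))
    (hadd : ∀ x y, P x → P y → P (x + y)) : P x := by
  have h0 : P 0 := by simpa using h 0 0 0 []
  have key : ∀ r c (y : ShuffleAlgebra (constants R) q.RT),
      P (ι q r * ofEval q c * ofShuffle q y) := by
    intro r c y
    induction y using ShuffleAlgebra.induction with
    | add y z hy hz => rw [map_add, mul_add]; exact hadd _ _ hy hz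
    | tmul d t =>
      rw [ofShuffle_tmul, ← mul_assoc]
      induction t using tensor_induction generalizing d with
      | pure l => exact h r c d l
      | add x y hx hy => rw [map_add, mul_add]; exact hadd _ _ (hx d) (hy d)
      | smul k t ht =>
        rw [map_smul, mul_smul_comm, ← smul_mul_assoc, ← mul_smul_comm, ← map_smul]
        exact ht _
  induction (x : R ⊗[constants R] _) using TensorProduct.induction_on with
  | zero => exact h0
  | add x y hx hy => exact hadd x y hx hy
  | tmul r y =>
    induction (y : EvalConstants q ⊗[constants R] _) using TensorProduct.induction_on with
    | zero => rw [TensorProduct.tmul_zero]; exact h0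
    | add x y hx hy => rw [TensorProduct.tmul_add]; exact hadd _ _ hx hy
    | tmul c y =>
      have : (r ⊗ₜ[constants R] (c ⊗ₜ[constants R] y) : IDR q) =
          ι q r * ofEval q c * ofShuffle q y := by
        exact tmul_eq_mul _ _ _
      rw [this]; exact key r c y

/-- The linear extension to `C₂ ⊗ T(R_T)` of a linear map `h` on tensors: `c ⊗ t ↦ c h(t)`. -/
def liftShuffle : (TensorAlgebra (constants R) q.RT →ₗ[constants R] IDR q) →ₗ[constants R]
    ShuffleAlgebra (constants R) q.RT →ₗ[constants R] IDR q :=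
  mulLift (ofProduct q).toLinearMap

theorem liftShuffle_tmul (h : TensorAlgebra (constants R) q.RT →ₗ[constants R] IDR q)
    (c : ProductConstants (constants R) q.RT) (t : TensorAlgebra (constants R) q.RT) :
    liftShuffle q h (ShuffleAlgebra.tmul c t) = ofProduct q c * h t := rfl

/-- The linear map with `f₀ ⊗ c ⊗ x ↦ c H(f₀, x)` for `f₀` in `R`, `c` in `C₁` and `x` in
`C₂ ⊗ T(R_T)`. -/
def extend (H : R →ₗ[constants R] ShuffleAlgebra (constants R) q.RT →ₗ[constants R] IDR q) :
    IDR q →ₗ[constants R] IDR q :=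
  (TensorProduct.lift ((mulLift (ofEval q).toLinearMap).comp H) :
    R ⊗[constants R] (EvalConstants q ⊗[constants R] ShuffleAlgebra (constants R) q.RT)
      →ₗ[constants R] IDR q)

theorem extend_apply
    (H : R →ₗ[constants R] ShuffleAlgebra (constants R) q.RT →ₗ[constants R] IDR q)
    (r : R) (c : EvalConstants q) (x : ShuffleAlgebra (constants R) q.RT) :
    extend q H (ι q r * ofEval q c * ofShuffle q x) = ofEval q c * H r x := by
  have : (r ⊗ₜ[constants R] (c ⊗ₜ[constants R] x) : IDR q) =
      ι q r * ofEval q c * ofShuffle q x := tmul_eq_mul _ _ _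
  rw [← this]
  rfl

/-! ### The derivation -/

/-- The linear map on tensors with `1 ↦ 0` and `a ⊗ t ↦ a ⊗ 1 ⊗ 1 ⊗ t`. -/
def derivTensor : TensorAlgebra (constants R) q.RT →ₗ[constants R] IDR q :=
  tensorRec 0 0
    ((LinearMap.mul (constants R) (IDR q)).compl₁₂ ((ι q).toLinearMap.comp q.RT.subtype)
      (ofTensor q))

theorem derivTensor_one : derivTensor q 1 = 0 := tensorRec_one _ _ _

theorem derivTensor_ι_mul (a : q.RT) (t : TensorAlgebra (constants R) q.RT) :
    derivTensor q (TensorAlgebra.ι _ a * t) = ι q a * ofTensor q t := by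
  rw [derivTensor, tensorRec_ι_mul]
  simp

/-- The derivation of `IDR(R)` as a linear map:
`∂(f₀ ⊗ c ⊗ 1) = ∂f₀ ⊗ c ⊗ 1` and `∂(f₀ ⊗ c ⊗ (a ⊗ t)) = ∂f₀ ⊗ c ⊗ (a ⊗ t) + f₀ a ⊗ c ⊗ t`. -/
def derivIDR : IDR q →ₗ[constants R] IDR q :=
  extend q
    ((LinearMap.mul (constants R) (IDR q)).compl₁₂ ((ι q).toLinearMap.comp (derivₗ R))
        (ofShuffle q).toLinearMap +
      (LinearMap.mul (constants R) (IDR q)).compl₁₂ (ι q).toLinearMap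
        (liftShuffle q (derivTensor q)))

theorem derivIDR_shuffle (r : R) (c : EvalConstants q)
    (x : ShuffleAlgebra (constants R) q.RT) :
    derivIDR q (ι q r * ofEval q c * ofShuffle q x) =
      ofEval q c * (ι q (r′) * ofShuffle q x + ι q r * liftShuffle q (derivTensor q) x) := by
  rw [derivIDR, extend_apply]
  rfl

theorem derivIDR_apply (r : R) (c : EvalConstants q)
    (d : ProductConstants (constants R) q.RT) (t : TensorAlgebra (constants R) q.RT) :
    derivIDR q (ι q r * ofEval q c * ofProduct q d * ofTensor q t) =
      ofEval q c * ofProduct q d * (ι q (r′) * ofTensor q t + ι q r * derivTensor q t) := by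
  rw [mul_assoc _ (ofProduct q d), ← ofShuffle_tmul, derivIDR_shuffle, liftShuffle_tmul,
    ofShuffle_tmul]
  ring

theorem ofTensor_eq (t : TensorAlgebra (constants R) q.RT) :
    ofTensor q t = ofShuffle q (ShuffleAlgebra.tmul 1 t) := rfl

theorem liftShuffle_prepend (a : q.RT) (x : ShuffleAlgebra (constants R) q.RT) :
    liftShuffle q (derivTensor q) (ShuffleAlgebra.prependHom a x) = ι q a * ofShuffle q x := by
  induction x using ShuffleAlgebra.induction with
  | add x y hx hy => rw [map_add, map_add, map_add, hx, hy, mul_add]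
  | tmul c t =>
    rw [ShuffleAlgebra.prependHom_tmul, liftShuffle_tmul, derivTensor_ι_mul, ofShuffle_tmul]
    ring

theorem liftShuffle_smul (d : ProductConstants (constants R) q.RT)
    (x : ShuffleAlgebra (constants R) q.RT) :
    liftShuffle q (derivTensor q) (d • x) = ofProduct q d * liftShuffle q (derivTensor q) x := by
  induction x using ShuffleAlgebra.induction with
  | add x y hx hy => rw [smul_add, map_add, map_add, hx, hy, mul_add]
  | tmul c t =>
    rw [ShuffleAlgebra.smul_tmul, liftShuffle_tmul, liftShuffle_tmul, map_mul, mul_assoc]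

theorem ofShuffle_smul (d : ProductConstants (constants R) q.RT)
    (x : ShuffleAlgebra (constants R) q.RT) :
    ofShuffle q (d • x) = ofProduct q d * ofShuffle q x := by
  rw [Algebra.smul_def, map_mul]
  rfl

theorem liftShuffle_mul (f g : List q.RT) :
    liftShuffle q (derivTensor q)
      (ShuffleAlgebra.tmul 1 (pureTensor f) * ShuffleAlgebra.tmul 1 (pureTensor g)) =
      derivTensor q (pureTensor f) * ofTensor q (pureTensor g) +
        ofTensor q (pureTensor f) * derivTensor q (pureTensor g) := by
  cases f with
  | nil =>
    rw [pureTensor_nil, ← ShuffleAlgebra.one_def, one_mul, liftShuffle_tmul, derivTensor_one,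
      ofTensor_one, map_one]
    ring
  | cons a f =>
    cases g with
    | nil =>
      rw [pureTensor_nil, ← ShuffleAlgebra.one_def, mul_one, liftShuffle_tmul, derivTensor_one,
        ofTensor_one, map_one]
      ring
    | cons b g =>
      rw [pureTensor_cons, pureTensor_cons, ShuffleAlgebra.tmul_ι_mul_tmul_ι, map_add, map_add,
        liftShuffle_prepend, liftShuffle_prepend, liftShuffle_tmul, derivTensor_one, map_mul,
        map_mul, derivTensor_ι_mul, derivTensor_ι_mul]
      simp only [← ofTensor_eq]
      ring

theorem derivIDR_mul (x y : IDR q) :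
    derivIDR q (x * y) = x * derivIDR q y + y * derivIDR q x := by
  induction x using IDR.induction with
  | hadd x x' hx hx' => simp only [add_mul, mul_add, map_add, hx, hx']; ring
  | h r c d f =>
    induction y using IDR.induction with
    | hadd y y' hy hy' => simp only [add_mul, mul_add, map_add, hy, hy']; ring
    | h s c' d' g =>
      have h : ι q r * ofEval q c * ofProduct q d * ofTensor q (pureTensor f) *
          (ι q s * ofEval q c' * ofProduct q d' * ofTensor q (pureTensor g)) =
          ι q (r * s) * ofEval q (c * c') *
            ofShuffle q ((d * d') •
              (ShuffleAlgebra.tmul 1 (pureTensor f) * ShuffleAlgebra.tmul 1 (pureTensor g))) := by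
        rw [ofShuffle_smul, map_mul (ofShuffle q), ← ofTensor_eq, ← ofTensor_eq]
        simp only [map_mul]
        ring
      rw [h, derivIDR_shuffle, liftShuffle_smul, liftShuffle_mul, ofShuffle_smul,
        map_mul (ofShuffle q), ← ofTensor_eq, ← ofTensor_eq, derivIDR_apply, derivIDR_apply,
        Derivation.leibniz]
      simp only [map_mul, map_add, smul_eq_mul]
      ring

instance : Differential (IDR q) where
  deriv := Derivation.mk' (derivIDR q).toAddMonoidHom.toIntLinearMap (derivIDR_mul q)

theorem deriv_def (x : IDR q) : x′ = derivIDR q x := rfl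

/-! ### The integration -/

/-- The bilinear map `(f₀, t) ↦ Qf₀ ⊗ 1 ⊗ 1 ⊗ t - 1 ⊗ ε(Qf₀ ⊗ t) ⊗ 1 ⊗ 1
+ 1 ⊗ 1 ⊗ 1 ⊗ ((f₀ - ∂Qf₀) ⊗ t)`, written as a map in `t` and `f₀`. -/
def intBase : TensorAlgebra (constants R) q.RT →ₗ[constants R] R →ₗ[constants R] IDR q :=
  (((LinearMap.mul (constants R) (IDR q)).compl₁₂ ((ι q).toLinearMap.comp q.Q) (ofTensor q)) -
    (((evalEps q).comp q.toRJ).compr₂ (ofEval q).toLinearMap) +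
    (((prepend (K := constants R) (M := q.RT)).comp q.toRT).compr₂ (ofTensor q))).flip

theorem intBase_apply (t : TensorAlgebra (constants R) q.RT) (r : R) :
    intBase q t r = ι q (q.Q r) * ofTensor q t - ofEval q (evalEps q (q.toRJ r) t) +
      ofTensor q (TensorAlgebra.ι _ (q.toRT r) * t) := rfl

/-- The map `(t, f₀) ↦ ∫(f₀ ⊗ 1 ⊗ 1 ⊗ t)`, by recursion on the length of tensors. -/
def intTensor : TensorAlgebra (constants R) q.RT →ₗ[constants R] R →ₗ[constants R] IDR q :=
  tensorRec
    ((LinearMap.llcomp (constants R) R R (IDR q)).flip.comp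
      ((LinearMap.mul (constants R) R).compl₁₂ (-q.Q) q.RT.subtype).flip)
    (intBase q 1)
    ((prepend (K := constants R) (M := q.RT)).compr₂ (intBase q))

theorem intTensor_one (r : R) :
    intTensor q 1 r = ι q (q.Q r) - ofEval q (evalEps q (q.toRJ r) 1) +
      ofTensor q (TensorAlgebra.ι _ (q.toRT r)) := by
  rw [intTensor, tensorRec_one, intBase_apply, ofTensor_one, mul_one, mul_one]

theorem intTensor_ι_mul (a : q.RT) (t : TensorAlgebra (constants R) q.RT) (r : R) :
    intTensor q (TensorAlgebra.ι _ a * t) r =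
      ι q (q.Q r) * ofTensor q (TensorAlgebra.ι _ a * t) -
        ofEval q (evalEps q (q.toRJ r) (TensorAlgebra.ι _ a * t)) -
        intTensor q t (q.Q r * a) +
        ofTensor q (TensorAlgebra.ι _ (q.toRT r) * (TensorAlgebra.ι _ a * t)) := by
  have h : intTensor q (TensorAlgebra.ι _ a * t) r =
      intTensor q t (-q.Q r * a) + intBase q (TensorAlgebra.ι _ a * t) r := by
    rw [intTensor, tensorRec_ι_mul]
    rfl
  rw [h, intBase_apply, neg_mul, map_neg]
  ring

/-- The integration of `IDR(R)` as a linear map: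
`∫(f₀ ⊗ c₁ ⊗ c₂ ⊗ t) = c₁ c₂ ∫(f₀ ⊗ 1 ⊗ 1 ⊗ t)`. -/
def intIDR : IDR q →ₗ[constants R] IDR q :=
  extend q ((liftShuffle q).comp (intTensor q).flip)

theorem intIDR_apply (r : R) (c : EvalConstants q)
    (d : ProductConstants (constants R) q.RT) (t : TensorAlgebra (constants R) q.RT) :
    intIDR q (ι q r * ofEval q c * ofProduct q d * ofTensor q t) =
      ofEval q c * ofProduct q d * intTensor q t r := by
  rw [mul_assoc _ (ofProduct q d), ← ofShuffle_tmul, intIDR, extend_apply, mul_assoc]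
  rfl

theorem deriv_mul_const (c : EvalConstants q) (d : ProductConstants (constants R) q.RT)
    (x : IDR q) :
    (ofEval q c * ofProduct q d * x)′ = ofEval q c * ofProduct q d * (x′) := by
  induction x using IDR.induction with
  | hadd x y hx hy => rw [mul_add, map_add, map_add, hx, hy, mul_add]
  | h r c' d' l =>
    have h : ofEval q c * ofProduct q d *
        (ι q r * ofEval q c' * ofProduct q d' * ofTensor q (pureTensor l)) =
        ι q r * ofEval q (c * c') * ofProduct q (d * d') * ofTensor q (pureTensor l) := by
      simp only [map_mul]; ring
    rw [h, deriv_def, deriv_def, derivIDR_apply, derivIDR_apply]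
    simp only [map_mul]; ring

theorem intIDR_mul_const (c : EvalConstants q) (d : ProductConstants (constants R) q.RT)
    (x : IDR q) :
    intIDR q (ofEval q c * ofProduct q d * x) = ofEval q c * ofProduct q d * intIDR q x := by
  induction x using IDR.induction with
  | hadd x y hx hy => rw [mul_add, map_add, map_add, hx, hy, mul_add]
  | h r c' d' l =>
    have h : ofEval q c * ofProduct q d *
        (ι q r * ofEval q c' * ofProduct q d' * ofTensor q (pureTensor l)) =
        ι q r * ofEval q (c * c') * ofProduct q (d * d') * ofTensor q (pureTensor l) := by
      simp only [map_mul]; ring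
    rw [h, intIDR_apply, intIDR_apply]
    simp only [map_mul]; ring

theorem deriv_ι_mul (r : R) (t : TensorAlgebra (constants R) q.RT) :
    (ι q r * ofTensor q t)′ = ι q (r′) * ofTensor q t + ι q r * derivTensor q t := by
  have h := derivIDR_apply q r 1 1 t
  rw [deriv_def]
  simpa only [map_one, mul_one, one_mul] using h

theorem intIDR_ι_mul (r : R) (t : TensorAlgebra (constants R) q.RT) :
    intIDR q (ι q r * ofTensor q t) = intTensor q t r := by
  have h := intIDR_apply q r 1 1 t
  simpa only [map_one, mul_one, one_mul] using h

theorem deriv_ofEval (c : EvalConstants q) : (ofEval q c)′ = 0 := by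
  have h := deriv_mul_const q c 1 1
  simpa only [map_one, mul_one, Derivation.map_one_eq_zero, mul_zero] using h

theorem deriv_ofProduct (d : ProductConstants (constants R) q.RT) : (ofProduct q d)′ = 0 := by
  have h := deriv_mul_const q 1 d 1
  simpa only [map_one, mul_one, one_mul, Derivation.map_one_eq_zero, mul_zero] using h

theorem deriv_ι (r : R) : (ι q r)′ = ι q (r′) := by
  have h := deriv_ι_mul q r 1
  simpa only [ofTensor_one, mul_one, derivTensor_one, mul_zero, add_zero] using h

theorem deriv_ofTensor_ι_mul (a : q.RT) (t : TensorAlgebra (constants R) q.RT) :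
    (ofTensor q (TensorAlgebra.ι _ a * t))′ = ι q a * ofTensor q t := by
  have h := deriv_ι_mul q 1 (TensorAlgebra.ι _ a * t)
  simpa only [map_one, one_mul, Derivation.map_one_eq_zero, map_zero, zero_mul, zero_add,
    derivTensor_ι_mul] using h

theorem deriv_intTensor (l : List q.RT) (r : R) :
    (intTensor q (pureTensor l) r)′ = ι q r * ofTensor q (pureTensor l) := by
  induction l generalizing r with
  | nil =>
    have h := deriv_ofTensor_ι_mul q (q.toRT r) 1
    rw [mul_one, ofTensor_one, mul_one] at h
    rw [pureTensor_nil, intTensor_one, map_add, map_sub, deriv_ι, deriv_ofEval, h, ofTensor_one,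
      sub_zero, mul_one, ← map_add, q.coe_toRT, add_sub_cancel]
  | cons a l ih =>
    rw [pureTensor_cons, intTensor_ι_mul, map_add, map_sub, map_sub, ih, deriv_ofEval,
      deriv_ofTensor_ι_mul, deriv_ι_mul, derivTensor_ι_mul, q.coe_toRT]
    simp only [map_mul, map_sub]
    ring

theorem deriv_intIDR (x : IDR q) : (intIDR q x)′ = x := by
  induction x using IDR.induction with
  | hadd x y hx hy => rw [map_add, map_add, hx, hy]
  | h r c d l =>
    rw [intIDR_apply, deriv_mul_const, deriv_intTensor]
    ring

theorem intTensor_RT (k : constants R) (a : q.RT) (l : List q.RT) :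
    intTensor q (pureTensor l) ((k : R) * a) =
      k • ofTensor q (TensorAlgebra.ι _ a * pureTensor l) := by
  have h : ((k : R) * a) = k • (a : R) := rfl
  rw [h, map_smul]
  congr 1
  cases l with
  | nil =>
    rw [pureTensor_nil, intTensor_one, q.Q_coe, q.toRJ_coe, q.toRT_coe]
    simp
  | cons b l =>
    rw [pureTensor_cons, intTensor_ι_mul, q.Q_coe, q.toRJ_coe, q.toRT_coe]
    simp

/-- Auxiliary predicate: multiplication by `z` commutes with the integration. -/
def CommutesWithInt (z : IDR q) : Prop := ∀ x, intIDR q (z * x) = z * intIDR q x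

theorem CommutesWithInt.add {z w : IDR q} (hz : CommutesWithInt q z) (hw : CommutesWithInt q w) :
    CommutesWithInt q (z + w) := fun x => by
  rw [add_mul, map_add, hz, hw, add_mul]

theorem commutesWithInt_algebraMap (k : constants R) :
    CommutesWithInt q (algebraMap _ _ k) := fun x => by
  rw [← Algebra.smul_def, ← Algebra.smul_def, map_smul]

theorem commutesWithInt_ofEval (c : EvalConstants q) :
    CommutesWithInt q (ofEval q c) := fun x => by
  have h := intIDR_mul_const q c 1 x
  simpa only [map_one, mul_one] using h

theorem commutesWithInt_eval_pure (r : R) (l : List q.RT) :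
    CommutesWithInt q (ι q r * ofTensor q (pureTensor l) -
      intIDR q (ι q r * ofTensor q (pureTensor l))′) := by
  have hk : r - q.Q (r′) ∈ constants R := by
    rw [mem_constants, map_sub, q.deriv_Q_deriv, sub_self]
  obtain ⟨k, hk'⟩ : ∃ k : constants R, (k : R) = r - q.Q (r′) := ⟨⟨_, hk⟩, rfl⟩
  have hι : ι q r = ι q (q.Q (r′)) + algebraMap _ _ k := by
    have : algebraMap (constants R) (IDR q) k = ι q (k : R) := ((ι q).commutes k).symm
    rw [this, ← map_add, hk', add_sub_cancel]
  rw [deriv_ι_mul, map_add, intIDR_ι_mul]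
  cases l with
  | nil =>
    rw [pureTensor_nil, intTensor_one, derivTensor_one, mul_zero, map_zero, q.toRT_deriv,
      ofTensor_one, mul_one, map_zero, map_zero]
    have : ι q r - (ι q (q.Q (r′)) - ofEval q (evalEps q (q.toRJ (r′)) 1) + 0 + 0) =
        algebraMap _ _ k + ofEval q (evalEps q (q.toRJ (r′)) 1) := by
      rw [hι]; ring
    rw [this]
    exact (commutesWithInt_algebraMap q k).add q (commutesWithInt_ofEval q _)
  | cons a l =>
    rw [pureTensor_cons, intTensor_ι_mul, derivTensor_ι_mul, q.toRT_deriv, map_zero, zero_mul,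
      map_zero, ← mul_assoc, ← map_mul, intIDR_ι_mul]
    have h1 : intTensor q (pureTensor l) (r * a) =
        intTensor q (pureTensor l) (q.Q (r′) * a) +
          algebraMap _ _ k * ofTensor q (TensorAlgebra.ι _ a * pureTensor l) := by
      rw [← Algebra.smul_def, ← intTensor_RT, ← map_add, hk']
      congr 1; ring
    have : ∀ A B C D E F : IDR q, A = B + C → F = D + C * E →
        A * E - (B * E - ofEval q (evalEps q (q.toRJ (r′))
          (TensorAlgebra.ι _ a * pureTensor l)) - D + 0 + F) =
        ofEval q (evalEps q (q.toRJ (r′)) (TensorAlgebra.ι _ a * pureTensor l)) := by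
      rintro A B C D E F rfl rfl; ring
    rw [this _ _ _ _ _ _ hι h1]
    exact commutesWithInt_ofEval q _

theorem commutesWithInt_eval (x : IDR q) : CommutesWithInt q (x - intIDR q (x′)) := by
  induction x using IDR.induction with
  | hadd x y hx hy =>
    rw [map_add, map_add, add_sub_add_comm]
    exact hx.add q hy
  | h r c d l =>
    have h : ι q r * ofEval q c * ofProduct q d * ofTensor q (pureTensor l) =
        ofEval q c * ofProduct q d * (ι q r * ofTensor q (pureTensor l)) := by ring
    rw [h, deriv_mul_const, intIDR_mul_const, ← mul_sub]
    intro x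
    rw [mul_assoc, intIDR_mul_const, commutesWithInt_eval_pure]
    ring

instance : Integration (IDR q) :=
  Integration.ofAdd (intIDR q) (map_add _)
    (fun c f hc => by
      have h := commutesWithInt_eval q c f
      rwa [hc, map_zero, sub_zero] at h)
    (deriv_intIDR q)

theorem int_def (x : IDR q) : int x = intIDR q x := rfl

end IDR

end FreeIntegroDifferentialRing

section Quotients

variable {A : Type*} [CommRing A] [Differential A]

/-- The derivation induced on the quotient by an ideal that is closed under the derivation. -/
@[reducible] def quotientDifferential (J : Ideal A) (hD : ∀ x ∈ J, x′ ∈ J) :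
    Differential (A ⧸ J) where
  deriv := Derivation.mk'
    (AddMonoidHom.toIntLinearMap (QuotientAddGroup.map J.toAddSubgroup J.toAddSubgroup
      (Differential.deriv (R := A)).toLinearMap.toAddMonoidHom hD : A ⧸ J →+ A ⧸ J)) (by
    rintro ⟨x⟩ ⟨y⟩
    exact congrArg (Ideal.Quotient.mk J) (Derivation.leibniz Differential.deriv x y))

/-- The integration induced on the quotient by an ideal that is closed under the derivation and the
integration. -/
@[reducible] def quotientIntegration [Integration A] (J : Ideal A) (hD : ∀ x ∈ J, x′ ∈ J)
    (hI : ∀ x ∈ J, int x ∈ J) :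
    letI := quotientDifferential J hD
    Integration (A ⧸ J) :=
  letI := quotientDifferential J hD
  Integration.ofAdd
    (QuotientAddGroup.map J.toAddSubgroup J.toAddSubgroup
      (Integration.int (A := A)).toAddMonoidHom hI : A ⧸ J →+ A ⧸ J)
    (map_add _)
    (by
      rintro ⟨x⟩ ⟨y⟩ hx
      have hx' : x′ ∈ J := Ideal.Quotient.eq_zero_iff_mem.mp hx
      have h : x - eval x ∈ J := by
        rw [eval, sub_sub_cancel]; exact hI _ hx'
      refine Ideal.Quotient.eq.mpr ?_
      change int (x * y) - x * int y ∈ J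
      have h2 : int (x * y) - x * int y =
          int ((x - eval x) * y) - (x - eval x) * int y := by
        have : x * y = (x - eval x) * y + eval x * y := by ring
        rw [this, int_add, int_const_mul (deriv_eval x)]
        ring
      rw [h2]
      exact J.sub_mem (hI _ (J.mul_mem_right _ h)) (J.mul_mem_right _ h))
    (by
      rintro ⟨x⟩
      exact congrArg (Ideal.Quotient.mk J) (deriv_int x))

theorem deriv_mem_span {s : Set A} (hs : ∀ c ∈ s, c′ = 0) (x : A) (hx : x ∈ Ideal.span s) :
    x′ ∈ Ideal.span s := by
  induction hx using Submodule.span_induction with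
  | mem x h => rw [hs x h]; exact Ideal.zero_mem _
  | zero => rw [map_zero]; exact Ideal.zero_mem _
  | add x y _ _ hx hy => rw [map_add]; exact Ideal.add_mem _ hx hy
  | smul a x h hx =>
    rw [smul_eq_mul, Derivation.leibniz]
    exact Ideal.add_mem _ (Ideal.mul_mem_left _ _ hx) (Ideal.mul_mem_right _ _ h)

theorem int_mem_span [Integration A] {s : Set A} (hs : ∀ c ∈ s, c′ = 0) (x : A)
    (hx : x ∈ Ideal.span s) : int x ∈ Ideal.span s := by
  have key : ∀ a, int (x * a) ∈ Ideal.span s := by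
    induction hx using Submodule.span_induction with
    | mem x h =>
      intro a
      rw [int_const_mul (hs x h)]
      exact Ideal.mul_mem_right _ _ (Ideal.subset_span h)
    | zero => intro a; rw [zero_mul, int_zero]; exact Ideal.zero_mem _
    | add x y _ _ hx hy => intro a; rw [add_mul, int_add]; exact Ideal.add_mem _ (hx a) (hy a)
    | smul b x h hx =>
      intro a
      have : b • x * a = x * (b * a) := by rw [smul_eq_mul]; ring
      rw [this]; exact hx _
  simpa using key 1

end Quotients

section InternalClosure

variable (R : Type*) (S : Type*) [CommRing R] [CommRing S] [Algebra R S] [Differential S]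
  [Integration S]

/-- The internal integro-differential closure of (the image of) `R` in `S`: the smallest subring of
`S` that contains the image of `R` and is closed under the derivation and the integration. -/
def internalClosure : Subring S :=
  sInf {B | (algebraMap R S).range ≤ B ∧ (∀ x ∈ B, x′ ∈ B) ∧ ∀ x ∈ B, int x ∈ B}

theorem algebraMap_mem_internalClosure (r : R) : algebraMap R S r ∈ internalClosure R S :=
  Subring.mem_sInf.mpr fun _ hB => hB.1 ⟨r, rfl⟩

theorem deriv_mem_internalClosure {x : S} (hx : x ∈ internalClosure R S) :
    x′ ∈ internalClosure R S :=
  Subring.mem_sInf.mpr fun B hB => hB.2.1 x (Subring.mem_sInf.mp hx B hB)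

theorem int_mem_internalClosure {x : S} (hx : x ∈ internalClosure R S) :
    int x ∈ internalClosure R S :=
  Subring.mem_sInf.mpr fun B hB => hB.2.2 x (Subring.mem_sInf.mp hx B hB)

/-- The restriction of the derivation of `S`. -/
instance : Differential (internalClosure R S) where
  deriv := Derivation.mk'
    { toFun := fun x => ⟨(x : S)′, deriv_mem_internalClosure R S x.2⟩
      map_add' := fun x y => Subtype.ext (map_add _ (x : S) (y : S))
      map_smul' := fun n x => Subtype.ext (map_zsmul _ n (x : S)) }
    (fun x y => Subtype.ext (Derivation.leibniz _ (x : S) (y : S)))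

theorem coe_deriv_internalClosure (x : internalClosure R S) :
    ((x′ : internalClosure R S) : S) = (x : S)′ := rfl

/-- The restriction of the integration of `S`. -/
instance : Integration (internalClosure R S) :=
  Integration.ofAdd (fun x => ⟨int (x : S), int_mem_internalClosure R S x.2⟩)
    (fun x y => Subtype.ext (int_add (x : S) (y : S)))
    (fun _ f hc => Subtype.ext (int_const_mul (congrArg Subtype.val hc) (f : S)))
    (fun x => Subtype.ext (deriv_int (x : S)))

theorem coe_int_internalClosure (x : internalClosure R S) :
    ((int x : internalClosure R S) : S) = int (x : S) := rfl

end InternalClosure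

section EvaluationIdeal

variable {R : Type*} [CommRing R] [Differential R] (q : QuasiIntegration R)
  (S : Type*) [CommRing S] [Differential S] [Integration S] [Algebra R S]
  {I : Type*} (a : I → q.RT)

/-- The nested integral `σ(W) = ∫ a_{w₁} ∫ a_{w₂} ⋯ ∫ a_{wₙ}` in `S` of a word `W`; the empty word
gives `1`. -/
def wordIntegral : List I → S
  | [] => 1
  | w :: W => int (algebraMap R S (a w) * wordIntegral W)

/-- The pure tensor `τ(W) = a_{w₁} ⊗ ⋯ ⊗ a_{wₙ}` of a word `W`. -/
def wordTensor {R : Type*} [CommRing R] [Differential R] {q : QuasiIntegration R}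
    {I : Type*} (a : I → q.RT) (W : List I) : TensorAlgebra (constants R) q.RT :=
  pureTensor (W.map a)

/-- The constants `1 ⊗ (ε(f ⊗ τ(W)) - E(f σ(W))) ⊗ 1 ⊗ 1` of `IDR(R)` for `f ∈ R_J` and words `W`.
Here the evaluation `E(f σ(W))`, taken in `S`, is regarded as the constant `c` of `R` that it is the
image of. -/
def evalRelations : Set (IDR q) :=
  {x | ∃ (f : q.RJ) (W : List I) (c : constants R),
    algebraMap R S c = eval (algebraMap R S f * wordIntegral q S a W) ∧
      x = IDR.ofEval q (evalEps q f (wordTensor a W) - algebraMap _ _ c)}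

/-- The constants `1 ⊗ 1 ⊗ (ε(τ(U) ⊙ τ(V)) - E(σ(U) σ(V))) ⊗ 1` of `IDR(R)` for nonempty words `U`
and `V`, with the evaluation regarded as a constant of `R`. -/
def productRelations : Set (IDR q) :=
  {x | ∃ (U V : List I) (c : constants R), U ≠ [] ∧ V ≠ [] ∧
    algebraMap R S c = eval (wordIntegral q S a U * wordIntegral q S a V) ∧
      x = IDR.ofProduct q
        (productEps (constants R) q.RT (wordTensor a U) (wordTensor a V) - algebraMap _ _ c)}

/-- The ideal `J` of `IDR(R)` generated by the constants `ε(⋯) - E(⋯)`. -/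
def evaluationIdeal : Ideal (IDR q) :=
  Ideal.span (evalRelations q S a ∪ productRelations q S a)

theorem deriv_relations (x : IDR q) (hx : x ∈ evalRelations q S a ∪ productRelations q S a) :
    x′ = 0 := by
  rcases hx with ⟨f, W, c, -, rfl⟩ | ⟨U, V, c, -, -, -, rfl⟩
  · exact IDR.deriv_ofEval q _
  · exact IDR.deriv_ofProduct q _

instance : Differential (IDR q ⧸ evaluationIdeal q S a) :=
  quotientDifferential _ (deriv_mem_span (deriv_relations q S a))

instance : Integration (IDR q ⧸ evaluationIdeal q S a) :=
  quotientIntegration _ (deriv_mem_span (deriv_relations q S a))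
    (int_mem_span (deriv_relations q S a))

theorem mk_deriv (x : IDR q) :
    Ideal.Quotient.mk (evaluationIdeal q S a) (x′) =
      (Ideal.Quotient.mk (evaluationIdeal q S a) x)′ := rfl

theorem mk_int (x : IDR q) :
    Ideal.Quotient.mk (evaluationIdeal q S a) (int x) =
      int (Ideal.Quotient.mk (evaluationIdeal q S a) x) := rfl

end EvaluationIdeal

end IntegroDiff

end

/-! Inside the closure every constant comes from R, so the evaluation of any element is the image of
a unique element of C. Hence the formal constants of IDR(R) can be given their actual values: ε(f ⊗
t) goes to E(f σ(t)) and ε(f ⊙ g) to E(σ(f) σ(g)), while a tensor goes to its nested integral. This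
defines the homomorphism `idrHom`.

Two facts make it well defined and compatible with the operations, and both are integration by
parts. First, a product of two nested integrals equals the integral of its derivative plus its
evaluation, and this is the recursion of the generalized shuffle product (`tensorEval_genProd`). The
relations defining C₂ therefore say that E(σ(f) σ(g) σ(h)) does not depend on the bracketing
(`symConstantsHom_constRel`). Second, f₀ = ∂Qf₀ + (f₀ - ∂Qf₀) splits ∫ f₀ σ(t) into a part
integrated by parts and a new nested integral, which is the defining formula of ∫ on IDR(R)
(`idrHom_intTensor`).

The image contains R and is closed under ∂ and ∫, so it is the whole closure. For the kernel,
dividing by J replaces all formal constants by elements of C, so every class is represented by a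
combination ∑ r_W τ(W) with coefficients in R (`exists_sub_wordCombination_mem`). Such a combination
is mapped to ∑ r_W σ(W), so the kernel is J once the σ(W) are linearly independent over R
(`evalWords_injective`).

Independence is a differential elimination. Among relations whose longest words have length n, the
coefficients that can occur at a fixed word of length n form a differential ideal of R. If it is
nonzero it contains a nonzero constant, and a relation with that constant as coefficient has a
derivative with one leading word fewer, which is trivial by induction. The coefficients of the
longest words are then constants, and for n > 0 comparing the words with first letter removed gives
a constant combination of the a_i that is a derivative. As R_T meets the derivatives only in zero
and the a_i are a basis, these constants vanish, a contradiction.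

Uniqueness also follows from the normal form: a homomorphism that commutes with ∫ and is fixed on R
has prescribed values on every ∑ r_W τ(W). -/

noncomputable section

namespace IntegroDiff

/-! ### Relations between nested integrals and their formal derivatives. -/

section LinearIndependence

variable {R : Type*} [CommRing R] [Differential R] (q : QuasiIntegration R)
  (S : Type*) [CommRing S] [Differential S] [Integration S] [Algebra R S]
  {I : Type*} (a : I → q.RT)

/-- The combination `∑ r_W σ(W)` of nested integrals with coefficients in `R`. -/
def evalWords : (List I →₀ R) →ₗ[R] S := Finsupp.linearCombination R (wordIntegral q S a)

/-- The linear map that sends the word `iW` to `a_i W`, and the empty word to zero. -/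
def shiftWords : (List I →₀ R) →ₗ[R] (List I →₀ R) :=
  Finsupp.linearCombination R fun W =>
    match W with
    | [] => 0
    | i :: W => Finsupp.single W (a i : R)

/-- The derivation of `∑ r_W W` when words are read as nested integrals. -/
def derivWords (v : List I →₀ R) : List I →₀ R :=
  v.mapRange (fun r : R => r′) (map_zero _) + shiftWords q a v

theorem cons_injective {I : Type*} (W : List I) : Function.Injective fun i : I => i :: W :=
  fun _ _ h => (List.cons.inj h).1

/-- Only the words iW contribute to W, each with the factor a_i. Reading the coefficient as a linear
combination of the a_i is what later allows the basis property to be used. -/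
theorem shiftWords_apply (v : List I →₀ R) (W : List I) :
    shiftWords q a v W = Finsupp.linearCombination R (fun i => (a i : R))
      (v.comapDomain (fun i => i :: W) (cons_injective W).injOn) := by
  classical
  induction v using Finsupp.induction_linear with
  | zero => simp
  | add v w hv hw =>
    rw [map_add, Finsupp.add_apply, hv, hw, Finsupp.comapDomain_add _ _
      (cons_injective W).injOn (cons_injective W).injOn, map_add]
  | single V r =>
    rw [shiftWords, Finsupp.linearCombination_single]
    have hz : (∀ i, V ≠ i :: W) → (Finsupp.single V r).comapDomain (fun i => i :: W)
        (cons_injective W).injOn = 0 := fun h => by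
      ext i
      rw [Finsupp.comapDomain_apply, Finsupp.single_apply, if_neg (h i), Finsupp.zero_apply]
    cases V with
    | nil => rw [hz (by simp)]; simp
    | cons j V =>
      by_cases h : V = W
      · subst h
        rw [Finsupp.comapDomain_single]
        simp
      · rw [hz (fun i hi => h (List.cons.inj hi).2)]
        simp [h]

theorem derivWords_apply (v : List I →₀ R) (W : List I) :
    derivWords q a v W = (v W)′ + shiftWords q a v W := by
  simp [derivWords]

/-- The product rule, together with ∂∫ = id, which strips the outermost integral of σ(iW) and leaves
a_i σ(W). Hence the formal derivative of a relation is again a relation. -/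
theorem deriv_evalWords [DifferentialAlgebra R S] (v : List I →₀ R) :
    (evalWords q S a v)′ = evalWords q S a (derivWords q a v) := by
  induction v using Finsupp.induction_linear with
  | zero => simp [derivWords]
  | add v w hv hw =>
    have : derivWords q a (v + w) = derivWords q a v + derivWords q a w := by
      ext W; simp only [derivWords_apply, Finsupp.add_apply, map_add]; ring
    rw [map_add, map_add, hv, hw, this, map_add]
  | single V r =>
    rw [derivWords, map_add, Finsupp.mapRange_single, evalWords, shiftWords,
      Finsupp.linearCombination_single, Finsupp.linearCombination_single,
      Finsupp.linearCombination_single, Algebra.smul_def, Derivation.leibniz, deriv_algebraMap]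
    cases V with
    | nil => simp [wordIntegral, Algebra.smul_def]
    | cons i V =>
      simp only [wordIntegral, deriv_int, map_smul, Finsupp.linearCombination_single, smul_eq_mul]
      simp only [Algebra.smul_def]
      ring

/-- The relations over `R` between nested integrals that involve only words of length less than `n`
and words in `A`. -/
def wordRelations (n : ℕ) (A : Set (List I)) : Submodule R (List I →₀ R) :=
  LinearMap.ker (evalWords q S a) ⊓ Finsupp.supported R R {W | W.length < n ∨ W ∈ A}

theorem mem_wordRelations {n : ℕ} {A : Set (List I)} {v : List I →₀ R} :
    v ∈ wordRelations q S a n A ↔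
      evalWords q S a v = 0 ∧ ∀ W, v W ≠ 0 → W.length < n ∨ W ∈ A := by
  rw [wordRelations, Submodule.mem_inf, LinearMap.mem_ker, Finsupp.mem_supported]
  simp [Set.subset_def]

/-- A contribution to W comes from a word one letter longer, hence of length greater than n, and no
such word occurs in these relations. So at words of length n the formal derivative acts on the
coefficient alone. -/
theorem shiftWords_eq_zero {n : ℕ} {A : Set (List I)} (hA : ∀ W ∈ A, W.length = n)
    {v : List I →₀ R} (hv : v ∈ wordRelations q S a n A) {W : List I} (hW : n ≤ W.length) :
    shiftWords q a v W = 0 := by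
  rw [shiftWords_apply]
  refine (congrArg _ (Finsupp.ext fun i => ?_)).trans (map_zero _)
  rw [Finsupp.comapDomain_apply, Finsupp.zero_apply]
  by_contra h
  rcases ((mem_wordRelations q S a).mp hv).2 _ h with h | h
  · simp at h; omega
  · have := hA _ h
    simp at this; omega

/-- Differentiation creates no new word of length n: a word outside the allowed set has coefficient
zero, hence derivative zero, and receives no shift contribution. -/
theorem derivWords_mem [DifferentialAlgebra R S] {n : ℕ} {A : Set (List I)}
    (hA : ∀ W ∈ A, W.length = n) {v : List I →₀ R} (hv : v ∈ wordRelations q S a n A) :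
    derivWords q a v ∈ wordRelations q S a n A := by
  have hv' := (mem_wordRelations q S a).mp hv
  refine (mem_wordRelations q S a).mpr ⟨?_, fun W hW => ?_⟩
  · rw [← deriv_evalWords, hv'.1, map_zero]
  · by_contra! h
    refine hW ?_
    rw [derivWords_apply, shiftWords_eq_zero q S a hA hv h.1, add_zero]
    have : v W = 0 := by
      by_contra hne
      rcases hv'.2 W hne with h' | h'
      · omega
      · exact h.2 h'
    rw [this, map_zero]

/-- Iterated derivation shows that top coefficients of relations form a differential ideal. -/
theorem differentialIdeal_le_map [DifferentialAlgebra R S] {n : ℕ} {A : Set (List I)}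
    (hA : ∀ W ∈ A, W.length = n) {v : List I →₀ R} (hv : v ∈ wordRelations q S a n A)
    {W : List I} (hW : W.length = n) :
    differentialIdeal (v W) ≤ (wordRelations q S a n A).map (Finsupp.lapply W) := by
  -- The image of a submodule under a coordinate map is an ideal, so it is enough to realise each
  -- iterated derivative of the coefficient.
  refine Submodule.span_le.mpr ?_
  rintro _ ⟨k, rfl⟩
  have : (derivWords q a)^[k] v ∈ wordRelations q S a n A ∧
      ((derivWords q a)^[k] v) W = (fun g : R => g′)^[k] (v W) := by
    induction k with
    | zero => exact ⟨hv, rfl⟩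
    | succ k ih =>
      rw [Function.iterate_succ_apply', Function.iterate_succ_apply']
      refine ⟨derivWords_mem q S a hA ih.1, ?_⟩
      rw [derivWords_apply, shiftWords_eq_zero q S a hA ih.1 hW.ge, add_zero, ih.2]
  exact ⟨_, this.1, this.2⟩

end LinearIndependence

/-! ### Linear independence of nested integrals over R. -/

section LinearIndependence

variable {R : Type*} [CommRing R] [Differential R] (q : QuasiIntegration R)
  (S : Type*) [CommRing S] [Differential S] [Integration S] [Algebra R S]
  {I : Type*} (a : Module.Basis I (constants R) q.RT)

/-- A relation between words of length at most `n` is trivial in degree `n` if its formal derivative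
vanishes. -/
theorem apply_eq_zero_of_derivWords_eq_zero (hRS : Function.Injective (algebraMap R S)) {n : ℕ}
    {A : Set (List I)} (hA : ∀ W ∈ A, W.length = n) {v : List I →₀ R}
    (hv : v ∈ wordRelations q S a n A) (hD : derivWords q a v = 0) {W : List I}
    (hW : W.length = n) : v W = 0 := by
  have hv' := (mem_wordRelations q S a).mp hv
  have hconst : ∀ V : List I, V.length = n → (v V)′ = 0 := fun V hV => by
    have := DFunLike.congr_fun hD V
    rwa [derivWords_apply, shiftWords_eq_zero q S a hA hv hV.ge, add_zero] at this
  cases W with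
  | nil =>
    -- For n = 0 only the empty word can occur. Its nested integral is 1, so the relation says that
    -- its coefficient vanishes in S.
    have hs : v = Finsupp.single [] (v []) := by
      ext V
      rw [Finsupp.single_apply]
      split_ifs with h
      · rw [h]
      · by_contra hne
        have : V.length = 0 := by
          rcases hv'.2 V hne with h' | h'
          · simp at hW; omega
          · rw [hA V h', ← hW]; rfl
        exact h (List.length_eq_zero_iff.mp this).symm
    have h := hv'.1
    rw [hs, evalWords, Finsupp.linearCombination_single] at h
    apply hRS
    rw [map_zero, ← h, wordIntegral, Algebra.smul_def, mul_one]
  | cons i W =>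
    have hlen : ∀ j : I, (j :: W).length = n := fun j => by simpa using hW
    -- All words jW have length n, so their coefficients are constants. The default value 0 only
    -- makes the function total on R and is never taken.
    let w : I →₀ constants R :=
      (v.comapDomain (fun i => i :: W) (cons_injective W).injOn).mapRange
        (fun r : R => by classical exact if h : r′ = 0 then ⟨r, h⟩ else 0) (by
          rw [dif_pos (map_zero _)]; rfl)
    have hw : ∀ j, (w j : R) = v (j :: W) := fun j =>
      congrArg Subtype.val (dif_pos (hconst _ (hlen j)))
    have hsum : shiftWords q a v W = (Finsupp.linearCombination (constants R) a w : q.RT) := by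
      have : (v.comapDomain (fun i => i :: W) (cons_injective W).injOn) =
          w.mapRange (fun c : constants R => (c : R)) rfl := by
        ext j
        rw [Finsupp.mapRange_apply, hw, Finsupp.comapDomain_apply]
      rw [shiftWords_apply, this, Finsupp.linearCombination_apply, Finsupp.linearCombination_apply,
        Finsupp.sum_mapRange_index (by simp), Finsupp.sum, Finsupp.sum,
        AddSubmonoidClass.coe_finsetSum]
      rfl
    have h0 := DFunLike.congr_fun hD W
    rw [derivWords_apply, hsum, Finsupp.zero_apply] at h0
    -- The coefficient at W gives ∂(v W) + ∑ v(jW) a_j = 0. Applying Q kills the sum, which lies in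
    -- R_T = ker Q, so Q∂(v W) = 0 and then ∂(v W) = ∂Q∂(v W) = 0.
    have hQ : (v W)′ = 0 := by
      have hq := q.Q_coe (Finsupp.linearCombination (constants R) a w)
      have hQ' := congrArg q.Q h0
      rw [map_add, hq, add_zero, map_zero] at hQ'
      rw [← q.deriv_Q_deriv, hQ', map_zero]
    rw [hQ, zero_add, ZeroMemClass.coe_eq_zero] at h0
    have := (linearIndependent_iff.mp a.linearIndependent) w h0
    rw [← hw, this]; rfl

/-- The elimination step, removing one word W of length n. If W had a nonzero coefficient, some
relation u would have a nonzero constant there. The derivative of u then has coefficient zero at W,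
so it is trivial by the induction hypothesis, and this forces the coefficient of u at W to vanish.
-/
theorem wordRelations_insert [DifferentialAlgebra R S]
    (hRS : Function.Injective (algebraMap R S))
    (hR : ∀ f : R, f ≠ 0 → ∃ c ∈ differentialIdeal f, c ≠ 0 ∧ c ∈ constants R)
    {n : ℕ} {A : Finset (List I)} {W : List I} {v : List I →₀ R} [DecidableEq (List I)]
    (ih : (∀ W ∈ A, W.length = n) → ∀ v ∈ wordRelations q S a n A, v = 0)
    (hA : ∀ V ∈ insert W A, V.length = n)
    (hv : v ∈ wordRelations q S a n (insert W A : Finset (List I))) : v = 0 := by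
  have hA' : ∀ V ∈ (↑(insert W A) : Set (List I)), V.length = n := fun V hV =>
      hA V (Finset.mem_coe.mp hV)
  have hW : W.length = n := hA W (Finset.mem_insert_self _ _)
  -- A relation with coefficient zero at W involves only the words in A in degree n, so the
  -- induction hypothesis applies to it.
  have hdrop : ∀ u ∈ wordRelations q S a n (insert W A : Finset (List I)), u W = 0 →
        u = 0 := fun u hu huW => by
    refine ih (fun V hV => hA V (Finset.mem_insert_of_mem hV)) u
      ((mem_wordRelations q S a).mpr ⟨((mem_wordRelations q S a).mp hu).1, fun V hV => ?_⟩)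
    rcases ((mem_wordRelations q S a).mp hu).2 V hV with h | h
    · exact Or.inl h
    · rcases Finset.mem_insert.mp (Finset.mem_coe.mp h) with rfl | h
      · exact absurd huW hV
      · exact Or.inr h
  refine hdrop v hv ?_
  by_contra hne
  obtain ⟨c, hc, hc0, hcc⟩ := hR _ hne
  -- The constant c lies in the differential ideal of the coefficient at W, hence is itself the
  -- coefficient at W of some relation u.
  obtain ⟨u, hu, rfl⟩ := differentialIdeal_le_map q S a hA' hv hW hc
  refine hc0 (apply_eq_zero_of_derivWords_eq_zero q S a hRS hA' hu ?_ hW)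
  refine hdrop _ (derivWords_mem q S a hA' hu) ?_
  rw [derivWords_apply, shiftWords_eq_zero q S a hA' hu hW.ge, add_zero]
  exact hcc

/-- Double induction, on the length n and on the finite set A of words allowed in length n. The
inner induction is needed because a relation may have several longest words, and the elimination
handles them one at a time. -/
theorem wordRelations_eq_bot [DifferentialAlgebra R S]
    (hRS : Function.Injective (algebraMap R S))
    (hR : ∀ f : R, f ≠ 0 → ∃ c ∈ differentialIdeal f, c ≠ 0 ∧ c ∈ constants R) (n : ℕ)
    (A : Finset (List I)) (hA : ∀ W ∈ A, W.length = n) (v : List I →₀ R)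
    (hv : v ∈ wordRelations q S a n A) : v = 0 := by
  classical
  induction n generalizing A v with
  | zero =>
    induction A using Finset.induction generalizing v with
    | empty =>
      ext W
      by_contra h
      simpa using ((mem_wordRelations q S a).mp hv).2 W h
    | insert W A hWA ih => exact wordRelations_insert q S a hRS hR ih hA hv
  | succ n ihn =>
    induction A using Finset.induction generalizing v with
    | empty =>
      -- With no words of length n + 1 left, the words of length n in the support of v become the
      -- new set of longest words.
      refine ihn (v.support.filter fun W => W.length = n) (by simp) v
        ((mem_wordRelations q S a).mpr ⟨((mem_wordRelations q S a).mp hv).1, fun W hW => ?_⟩)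
      have := ((mem_wordRelations q S a).mp hv).2 W hW
      simp [hW] at this ⊢
      omega
    | insert W A hWA ih => exact wordRelations_insert q S a hRS hR ih hA hv
/-- The nested integrals of words are linearly independent over `R`. -/
theorem evalWords_injective [DifferentialAlgebra R S]
    (hRS : Function.Injective (algebraMap R S))
    (hR : ∀ f : R, f ≠ 0 → ∃ c ∈ differentialIdeal f, c ≠ 0 ∧ c ∈ constants R) :
    Function.Injective (evalWords q S a) := by
  classical
  rw [injective_iff_map_eq_zero]
  intro v hv
  -- The bound exceeds the length of every word in the support, so no words need to be listed in top
  -- degree.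
  refine wordRelations_eq_bot q S a hRS hR (v.support.sup List.length + 1) ∅ (by simp) v
    ((mem_wordRelations q S a).mpr ⟨hv, fun W hW => Or.inl ?_⟩)
  exact Nat.lt_succ_of_le (Finset.le_sup (f := List.length) (Finsupp.mem_support_iff.mpr hW))

end LinearIndependence

/-! ### Evaluation and integration by parts. -/

section IntegrationByParts

variable {A : Type*} [CommRing A] [Differential A] [Integration A]

theorem eval_int (f : A) : eval (int f) = 0 := by rw [eval, deriv_int, sub_self]

theorem int_deriv (f : A) : int (f′) = f - eval f := by rw [eval, sub_sub_cancel]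

theorem eval_add (f g : A) : eval (f + g) = eval f + eval g := by
  simp only [eval, map_add, int_add]; ring

theorem eval_const_mul {c : A} (hc : c′ = 0) (f : A) : eval (c * f) = c * eval f := by
  rw [eval, eval, Derivation.leibniz, hc, smul_zero, add_zero, smul_eq_mul, int_const_mul hc]
  ring

/-- Integrate the product rule for f g. The evaluation term is needed because ∫∂ = id - E, and E is
not assumed multiplicative. -/
theorem int_deriv_mul (f g : A) :
    int (f′ * g) = f * g - eval (f * g) - int (f * g′) := by
  rw [← int_deriv, Derivation.leibniz, smul_eq_mul, smul_eq_mul, int_add, mul_comm g]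
  ring

end IntegrationByParts

/-! ### The relations of C₂ as an associativity law. -/

section PositiveTensors

variable (K : Type*) {M : Type*} [CommRing K] [AddCommGroup M] [Module K M]

theorem coe_positivePart_ι_mul (a : M) (t : TensorAlgebra K M) :
    (positivePart K M (TensorAlgebra.ι K a * t) : TensorAlgebra K M) = TensorAlgebra.ι K a * t := by
  change TensorAlgebra.ι K a * t - algebraMap K _ (TensorAlgebra.algebraMapInv _) = _
  simp [TensorAlgebra.algebraMapInv]

/-- The relations on the constants express associativity of the generalized shuffle product. -/
theorem constRel_eq (f g h : List M) :
    constRel K f g h =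
      extE (symEps K M) (pureTensor h) (genProd (symEps K M) (pureTensor f) (pureTensor g)) -
        extE (symEps K M) (pureTensor f) (genProd (symEps K M) (pureTensor g) (pureTensor h)) := by
  rw [genProd_pureTensor, genProd_pureTensor, constRel]
  simp only [map_add, map_sum, extE_tmul, one_mul]
  rw [Finset.sum_comm, Finset.sum_sub_distrib]
  -- The term with both indices zero, omitted in the relation, contains ε(1 ⊙ h), which is zero by
  -- convention. The sums may therefore start at zero, as in the explicit product formula.
  have h1 : ∀ j, (∑ i ∈ Finset.Ico (1 - j) f.length,
          symEps K M (pureTensor (f.drop i)) (pureTensor (g.drop j)) *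
            symEps K M (shuffle (pureTensor (f.take i)) (pureTensor (g.take j)))
              (pureTensor h)) = ∑ i ∈ Finset.range f.length,
          symEps K M (pureTensor (f.drop i)) (pureTensor (g.drop j)) *
            symEps K M (shuffle (pureTensor (f.take i)) (pureTensor (g.take j)))
              (pureTensor h) := fun j => sum_Ico_one_sub _ _ _ (by
    rintro rfl; simp [symEps_one_left])
  have h2 : ∀ j, (∑ k ∈ Finset.Ico (1 - j) h.length,
          symEps K M (pureTensor f)
            (shuffle (pureTensor (g.take j)) (pureTensor (h.take k))) *
            symEps K M (pureTensor (g.drop j)) (pureTensor (h.drop k))) =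
        ∑ k ∈ Finset.range h.length,
          symEps K M (pureTensor (g.drop j)) (pureTensor (h.drop k)) *
          symEps K M (shuffle (pureTensor (g.take j)) (pureTensor (h.take k)))
            (pureTensor f) := fun j => by
    rw [sum_Ico_one_sub]
    · refine Finset.sum_congr rfl fun k _ => ?_
      rw [mul_comm, symEps_comm K M (pureTensor f)]
    · rintro rfl
      simp [symEps_one_right]
  simp only [h1, h2]
  rw [symEps_comm K M (pureTensor f)]
  abel

end PositiveTensors

/-! ### Maps out of the symmetric product. -/

section SymSquare

variable (K : Type*) {P N : Type*} [CommRing K] [AddCommGroup P] [Module K P] [AddCommGroup N]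
  [Module K N]

/-- The linear map on the symmetric product given by a symmetric bilinear map. -/
def symLift (B : P →ₗ[K] P →ₗ[K] N) (hB : ∀ f g, B f g = B g f) : SymSquare K P →ₗ[K] N :=
  Submodule.liftQ _ (TensorProduct.lift B) (by
    rw [Submodule.span_le]
    rintro _ ⟨⟨f, g⟩, rfl⟩
    simp [hB f g])

theorem symSquare_ext {F G : SymSquare K P →ₗ[K] N}
    (h : ∀ f g, F (symMul K P f g) = G (symMul K P f g)) : F = G :=
  Submodule.linearMap_qext _ (TensorProduct.ext' h)

end SymSquare

/-! ### The generators of C₂. -/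

section PositiveTensors

variable (K M : Type*) [CommRing K] [AddCommGroup M] [Module K M]

theorem positivePart_coe (f : positiveTensors K M) : positivePart K M f = f := by
  apply Subtype.ext
  change (f : TensorAlgebra K M) -
    algebraMap K _ (TensorAlgebra.algebraMapInv (f : TensorAlgebra K M)) = f
  have h : TensorAlgebra.algebraMapInv (f : TensorAlgebra K M) = 0 := f.2
  rw [h, map_zero, sub_zero]

theorem symEps_coe (f g : positiveTensors K M) :
    symEps K M f g = symConstantsι K M (symMul K _ f g) := by
  rw [symEps, LinearMap.compl₁₂_apply, positivePart_coe, positivePart_coe]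
  rfl

/-- The elements ε(f ⊙ g) generate C₂: on positive tensors the projection in `symEps` is the
identity, so they are the images of the generators of the symmetric algebra. -/
theorem productConstants_algHom_ext {B : Type*} [CommRing B] [Algebra K B]
    {F G : ProductConstants K M →ₐ[K] B}
    (h : ∀ f g, F (productEps K M f g) = G (productEps K M f g)) : F = G := by
  suffices h' : F.comp (productConstantsMk K M) = G.comp (productConstantsMk K M) by
    ext x
    obtain ⟨x, rfl⟩ := Ideal.Quotient.mk_surjective x
    exact DFunLike.congr_fun h' x
  refine SymmetricAlgebra.algHom_ext (symSquare_ext _ fun f g => ?_)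
  have h' := h f g
  rwa [productEps_apply, symEps_coe] at h'

end PositiveTensors

/-! ### Constants of R inside an extension. -/

section Constants

variable {R : Type*} (S : Type*) [CommRing R] [Differential R] [CommRing S] [Algebra R S]

theorem deriv_algebraMap_constants [Differential S] [DifferentialAlgebra R S]
    (c : constants R) : (algebraMap (constants R) S c)′ = 0 := by
  change (algebraMap R S c)′ = 0
  rw [deriv_algebraMap, deriv_coe, map_zero]

theorem algebraMap_constants_injective {S : Type*} [CommRing S] [Algebra R S]
    (hRS : Function.Injective (algebraMap R S)) :
    Function.Injective (algebraMap (constants R) S) :=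
  fun _ _ h => Subtype.ext (hRS h)

end Constants

/-! ### The homomorphism from IDR(R) to an extension without new constants. -/

section Homomorphism

variable {R : Type*} [CommRing R] [Differential R] (q : QuasiIntegration R)
  (S : Type*) [CommRing S] [Differential S] [Integration S] [Algebra R S]
  [DifferentialAlgebra R S]

/-- The integration of an extension as a map that is linear over the constants of the base ring. -/
def intₗ : S →ₗ[constants R] S where
  toFun := int
  map_add' := int_add
  map_smul' c x := by
    rw [Algebra.smul_def, int_const_mul (deriv_algebraMap_constants S c), ← Algebra.smul_def]
    rfl

/-- The nested integral of a tensor: `1 ↦ 1` and `a ⊗ t ↦ ∫ a σ(t)`. -/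
def nestedIntegral : TensorAlgebra (constants R) q.RT →ₗ[constants R] S :=
  tensorRec (((LinearMap.mul (constants R) S).comp
    ((IsScalarTower.toAlgHom (constants R) R S).toLinearMap.comp q.RT.subtype)).compr₂ (intₗ S)) 1 0

@[simp] theorem nestedIntegral_one : nestedIntegral q S 1 = 1 := tensorRec_one _ _ _

@[simp] theorem nestedIntegral_ι_mul (a : q.RT) (t : TensorAlgebra (constants R) q.RT) :
    nestedIntegral q S (TensorAlgebra.ι _ a * t) =
      int (algebraMap R S a * nestedIntegral q S t) := by
  rw [nestedIntegral, tensorRec_ι_mul]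
  exact add_zero _

theorem nestedIntegral_wordTensor {I : Type*} (a : I → q.RT) (W : List I) :
    nestedIntegral q S (wordTensor a W) = wordIntegral q S a W := by
  induction W with
  | nil => exact nestedIntegral_one q S
  | cons i W ih =>
    rw [wordTensor, List.map_cons, pureTensor_cons, nestedIntegral_ι_mul, wordIntegral, ← ih]
    rfl

variable {S} (hRS : Function.Injective (algebraMap R S))
  (hC : ∀ x : S, x′ = 0 → ∃ c : constants R, algebraMap R S c = x)

/-- The evaluation of an extension without new constants, as a map to the constants of the base
ring. -/
def evalConst : S →ₗ[constants R] constants R where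
  toFun x := (hC (eval x) (deriv_eval x)).choose
  map_add' x y := by
    apply Subtype.ext
    apply hRS
    rw [Subring.coe_add, map_add, (hC _ (deriv_eval (x + y))).choose_spec,
      (hC _ (deriv_eval x)).choose_spec, (hC _ (deriv_eval y)).choose_spec, eval_add]
  map_smul' c x := by
    apply Subtype.ext
    apply hRS
    rw [RingHom.id_apply, smul_eq_mul, Subring.coe_mul, map_mul,
      (hC _ (deriv_eval (c • x))).choose_spec, (hC _ (deriv_eval x)).choose_spec,
      Algebra.smul_def, eval_const_mul (deriv_algebraMap_constants S c)]
    rfl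

theorem algebraMap_evalConst (x : S) :
    algebraMap (constants R) S (evalConst hRS hC x) = eval x :=
  (hC (eval x) (deriv_eval x)).choose_spec

theorem evalConst_int (x : S) : evalConst hRS hC (int x) = 0 := by
  apply algebraMap_constants_injective hRS
  rw [algebraMap_evalConst, eval_int, map_zero]

/-- The values of the generators of `C₁` in the constants. -/
def evalConstantsHom : EvalConstants q →ₐ[constants R] constants R :=
  SymmetricAlgebra.lift (TensorProduct.lift
    (((LinearMap.mul (constants R) S).compl₁₂
      ((IsScalarTower.toAlgHom (constants R) R S).toLinearMap.comp q.RJ.subtype)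
      (nestedIntegral q S)).compr₂ (evalConst hRS hC)))

theorem evalConstantsHom_evalEps (f : q.RJ) (t : TensorAlgebra (constants R) q.RT) :
    evalConstantsHom q hRS hC (evalEps q f t) =
      evalConst hRS hC (algebraMap R S f * nestedIntegral q S t) := by
  refine (SymmetricAlgebra.lift_ι_apply _ _).trans ?_
  rfl

/-- The values of the generators `ε(f ⊙ g)` in the constants. -/
def symSquareEval : SymSquare (constants R) (positiveTensors (constants R) q.RT) →ₗ[constants R]
    constants R :=
  symLift _
    (((LinearMap.mul (constants R) S).compl₁₂
      ((nestedIntegral q S).comp (Submodule.subtype _))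
      ((nestedIntegral q S).comp (Submodule.subtype _))).compr₂ (evalConst hRS hC))
    (fun f g => by simp [mul_comm])

/-- The algebra homomorphism on `SymConstants` given by the values of the generators. -/
def symConstantsHom : SymConstants (constants R) q.RT →ₐ[constants R] constants R :=
  SymmetricAlgebra.lift (symSquareEval q hRS hC)

theorem symConstantsHom_symEps (f g : TensorAlgebra (constants R) q.RT) :
    symConstantsHom q hRS hC (symEps _ _ f g) =
      evalConst hRS hC (nestedIntegral q S (positivePart _ _ f) *
        nestedIntegral q S (positivePart _ _ g)) := by
  refine (SymmetricAlgebra.lift_ι_apply _ _).trans ?_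
  rfl

section

variable (S) {B : Type*} [CommRing B] [Algebra (constants R) B] (κ : B →ₐ[constants R] constants R)

/-- The linear map `c ⊗ t ↦ κ(c) σ(t)`. -/
def tensorEval :
    B ⊗[constants R] TensorAlgebra (constants R) q.RT →ₗ[constants R] S :=
  mulLift ((Algebra.linearMap (constants R) S).comp κ.toLinearMap) (nestedIntegral q S)

theorem tensorEval_tmul (c : B) (t : TensorAlgebra (constants R) q.RT) :
    tensorEval q S κ (c ⊗ₜ t) = algebraMap (constants R) S (κ c) * nestedIntegral q S t := rfl

theorem tensorEval_smul (c : B) (x : B ⊗[constants R] TensorAlgebra (constants R) q.RT) :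
    tensorEval q S κ (c • x) = algebraMap (constants R) S (κ c) * tensorEval q S κ x := by
  induction x with
  | zero => simp
  | add x y hx hy => rw [smul_add, map_add, map_add, hx, hy, mul_add]
  | tmul d t =>
    rw [TensorProduct.smul_tmul', tensorEval_tmul, tensorEval_tmul, smul_eq_mul, map_mul, map_mul,
      mul_assoc]

theorem tensorEval_prependB (a : q.RT) (x : B ⊗[constants R] TensorAlgebra (constants R) q.RT) :
    tensorEval q S κ (prependB (constants R) q.RT B a x) =
      int (algebraMap R S a * tensorEval q S κ x) := by
  induction x with
  | zero => simp [int_zero]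
  | add x y hx hy => rw [map_add, map_add, map_add, hx, hy, mul_add, int_add]
  | tmul d t =>
    rw [prependB_tmul, tensorEval_tmul, tensorEval_tmul, nestedIntegral_ι_mul, mul_left_comm,
      int_const_mul (deriv_algebraMap_constants S (κ d))]

variable {S} (e : TensorAlgebra (constants R) q.RT →ₗ[constants R]
  TensorAlgebra (constants R) q.RT →ₗ[constants R] B)

/-- The product of two nested integrals is given by the generalized shuffle product. -/
theorem tensorEval_genProd
    (he : ∀ f g, κ (e f g) = evalConst hRS hC (nestedIntegral q S (positivePart _ _ f) *
        nestedIntegral q S (positivePart _ _ g))) (f g : TensorAlgebra (constants R) q.RT) :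
    tensorEval q S κ (genProd e f g) = nestedIntegral q S f * nestedIntegral q S g := by
  suffices h : (genProd e).compr₂ (tensorEval q S κ) =
      (LinearMap.mul (constants R) S).compl₁₂ (nestedIntegral q S) (nestedIntegral q S) from
    LinearMap.congr_fun (LinearMap.congr_fun h f) g
  refine ext_pureTensor fun f => ext_pureTensor fun g => ?_
  change tensorEval q S κ (genProd e (pureTensor f) (pureTensor g)) =
    nestedIntegral q S (pureTensor f) * nestedIntegral q S (pureTensor g)
  induction f generalizing g with
  | nil => simp [tensorEval_tmul]
  | cons a f ihf =>
    induction g with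
    | nil => simp [tensorEval_tmul]
    | cons b g ihg =>
      have ihf' := ihf (b :: g)
      rw [pureTensor_cons] at ihf' ihg
      rw [pureTensor_cons, pureTensor_cons, genProd_mul_mul, map_add, map_add, tensorEval_prependB,
        tensorEval_prependB, ihf', ihg, tensorEval_tmul, he, algebraMap_evalConst,
        coe_positivePart_ι_mul, coe_positivePart_ι_mul, nestedIntegral_one, mul_one,
        ← int_add]
      -- The product σ(af) σ(bg) equals the integral of its derivative plus its evaluation. The
      -- first two terms of the shuffle recursion give the integral, and the constant term gives the
      -- evaluation.
      have h := int_deriv (nestedIntegral q S (TensorAlgebra.ι _ a * pureTensor f) *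
        nestedIntegral q S (TensorAlgebra.ι _ b * pureTensor g))
      rw [eq_sub_iff_add_eq] at h
      refine Eq.trans ?_ h
      rw [Derivation.leibniz]
      simp only [nestedIntegral_ι_mul, deriv_int, smul_eq_mul]
      congr 2
      ring

/-- Reads the formal evaluation against h as the evaluation of a product with σ(h), so that each
half of a C₂ relation becomes the evaluation of a triple product. The coefficient algebra B is
arbitrary because the relations have to be checked in the symmetric algebra, before C₂ can be mapped
anywhere. -/
theorem extE_eq_evalConst
    (he : ∀ f g, κ (e f g) = evalConst hRS hC (nestedIntegral q S (positivePart _ _ f) *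
        nestedIntegral q S (positivePart _ _ g))) (h : List q.RT) (hh : h ≠ [])
    (x : B ⊗[constants R] TensorAlgebra (constants R) q.RT) :
    κ (extE e (pureTensor h) x) =
      evalConst hRS hC (tensorEval q S κ x * nestedIntegral q S (pureTensor h)) := by
  obtain ⟨b, h, rfl⟩ := List.exists_cons_of_ne_nil hh
  have key : ∀ f : List q.RT, κ (e (pureTensor f) (pureTensor (b :: h))) =
      evalConst hRS hC (nestedIntegral q S (pureTensor f) *
        nestedIntegral q S (pureTensor (b :: h))) := by
    intro f
    rw [he, pureTensor_cons, coe_positivePart_ι_mul]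
    cases f with
    -- The formal value of ε(1 ⊙ h) is zero. This agrees with the evaluation of σ(h) because h is
    -- nonempty, so that σ(h) is an integral and E∫ = 0.
    | nil =>
      rw [pureTensor_nil, positivePart_one, ZeroMemClass.coe_zero, map_zero, zero_mul, map_zero,
        nestedIntegral_one, one_mul, nestedIntegral_ι_mul, evalConst_int]
    | cons a f => rw [pureTensor_cons, coe_positivePart_ι_mul]
  have key' : ∀ f, κ (e f (pureTensor (b :: h))) =
      evalConst hRS hC (nestedIntegral q S f * nestedIntegral q S (pureTensor (b :: h))) := by
    intro f
    induction f using tensor_induction with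
    | pure l => exact key l
    | add x y hx hy => simp only [map_add, LinearMap.add_apply, add_mul, hx, hy]
    | smul c x hx => simp only [map_smul, LinearMap.smul_apply, smul_mul_assoc, hx]
  induction x with
  | zero => simp
  | add x y hx hy => simp only [map_add, add_mul, hx, hy]
  | tmul c f =>
    rw [extE_tmul, map_mul, key', tensorEval_tmul, mul_assoc, ← Algebra.smul_def, map_smul,
      smul_eq_mul]

end

/-- The two halves of the relation have values E((σ(f) σ(g)) σ(h)) and E((σ(g) σ(h)) σ(f)), which
agree by associativity and commutativity in S. -/
theorem symConstantsHom_constRel (f g h : List q.RT) (hf : f ≠ []) (hh : h ≠ []) :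
    symConstantsHom q hRS hC (constRel (constants R) f g h) = 0 := by
  rw [constRel_eq, map_sub,
    extE_eq_evalConst q hRS hC _ _ (symConstantsHom_symEps q hRS hC) _ hf,
    extE_eq_evalConst q hRS hC _ _ (symConstantsHom_symEps q hRS hC) _ hh,
    tensorEval_genProd q hRS hC _ _ (symConstantsHom_symEps q hRS hC),
    tensorEval_genProd q hRS hC _ _ (symConstantsHom_symEps q hRS hC), sub_eq_zero]
  congr 1
  ring

/-- The values of the generators of `C₂` in the constants. -/
def productConstantsHom : ProductConstants (constants R) q.RT →ₐ[constants R] constants R :=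
  Ideal.Quotient.liftₐ (constRelIdeal (constants R) q.RT) (symConstantsHom q hRS hC) (by
    suffices h : constRelIdeal (constants R) q.RT ≤ RingHom.ker (symConstantsHom q hRS hC) from
      fun x hx => h hx
    refine Ideal.span_le.mpr ?_
    rintro _ ⟨f, g, h, hf, -, hh, rfl⟩
    exact symConstantsHom_constRel q hRS hC f g h hf hh)

theorem productConstantsHom_productEps (f g : TensorAlgebra (constants R) q.RT) :
    productConstantsHom q hRS hC (productEps _ _ f g) =
      evalConst hRS hC (nestedIntegral q S (positivePart _ _ f) *
        nestedIntegral q S (positivePart _ _ g)) :=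
  symConstantsHom_symEps q hRS hC f g

/-- The homomorphism `c ⊗ t ↦ c σ(t)` on `C₂ ⊗ T(R_T)`. -/
def shuffleHom : ShuffleAlgebra (constants R) q.RT →ₐ[constants R] S :=
  AlgHom.ofLinearMap
    (tensorEval q S (productConstantsHom q hRS hC) :
      ShuffleAlgebra (constants R) q.RT →ₗ[constants R] S)
    (by
      refine (tensorEval_tmul q S _ 1 1).trans ?_
      rw [map_one, map_one, nestedIntegral_one, one_mul])
    (fun x y => by
      -- Both sides are bilinear over C₂, so multiplicativity reduces to `tensorEval_genProd` on
      -- pairs of tensors.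
      change tensorEval q S _ (genMul (productEps (constants R) q.RT) x.toTensor y.toTensor) =
        tensorEval q S _ x.toTensor * tensorEval q S _ y.toTensor
      induction x.toTensor with
      | zero => simp
      | add x y hx hy => simp only [map_add, LinearMap.add_apply, add_mul, hx, hy]
      | tmul c f =>
        induction y.toTensor with
        | zero => simp
        | add x y hx hy => simp only [map_add, mul_add, hx, hy]
        | tmul d g =>
          rw [genMul_tmul_tmul, tensorEval_smul, tensorEval_genProd q hRS hC _ _
            (productConstantsHom_productEps q hRS hC), tensorEval_tmul, tensorEval_tmul, map_mul,
            map_mul]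
          ring)

/-- The canonical homomorphism from the free integro-differential ring to an extension without new
constants. -/
def idrHom : IDR q →ₐ[constants R] S :=
  Algebra.TensorProduct.productMap (IsScalarTower.toAlgHom (constants R) R S)
    (Algebra.TensorProduct.productMap
      ((Algebra.ofId (constants R) S).comp (evalConstantsHom q hRS hC)) (shuffleHom q hRS hC))

theorem idrHom_ι (r : R) : idrHom q hRS hC (IDR.ι q r) = algebraMap R S r :=
  Algebra.TensorProduct.productMap_left_apply _ _ _

theorem idrHom_ofEval (c : EvalConstants q) :
    idrHom q hRS hC (IDR.ofEval q c) =
      algebraMap (constants R) S (evalConstantsHom q hRS hC c) :=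
  (Algebra.TensorProduct.productMap_right_apply _ _ _).trans
    (Algebra.TensorProduct.productMap_left_apply _ _ _)

theorem idrHom_ofShuffle (x : ShuffleAlgebra (constants R) q.RT) :
    idrHom q hRS hC (IDR.ofShuffle q x) = shuffleHom q hRS hC x :=
  (Algebra.TensorProduct.productMap_right_apply _ _ _).trans
    (Algebra.TensorProduct.productMap_right_apply _ _ _)

theorem idrHom_ofProduct (d : ProductConstants (constants R) q.RT) :
    idrHom q hRS hC (IDR.ofProduct q d) =
      algebraMap (constants R) S (productConstantsHom q hRS hC d) := by
  refine (idrHom_ofShuffle q hRS hC _).trans ((tensorEval_tmul q S _ d 1).trans ?_)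
  rw [nestedIntegral_one, mul_one]

theorem idrHom_ofTensor (t : TensorAlgebra (constants R) q.RT) :
    idrHom q hRS hC (IDR.ofTensor q t) = nestedIntegral q S t := by
  refine (idrHom_ofShuffle q hRS hC _).trans ((tensorEval_tmul q S _ 1 t).trans ?_)
  rw [map_one, map_one, one_mul]

theorem idrHom_derivTensor (l : List q.RT) :
    idrHom q hRS hC (IDR.derivTensor q (pureTensor l)) = (nestedIntegral q S (pureTensor l))′ := by
  cases l with
  | nil => simp [IDR.derivTensor_one]
  | cons a l =>
    rw [pureTensor_cons, IDR.derivTensor_ι_mul, map_mul, idrHom_ι, idrHom_ofTensor,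
      nestedIntegral_ι_mul, deriv_int]

/-- Induction on the length of the tensor, with the coefficient in R arbitrary since it changes from
r to (Qr)a. The part ∂Qr of r is integrated by parts, which produces the product term, the
evaluation and the integral of a shorter tensor. The remaining part of r lies in R_T and yields a
nested integral one letter longer. -/
theorem idrHom_intTensor (l : List q.RT) (r : R) :
    idrHom q hRS hC (IDR.intTensor q (pureTensor l) r) =
      int (algebraMap R S r * nestedIntegral q S (pureTensor l)) := by
  have hr : algebraMap R S r = (algebraMap R S (q.Q r))′ + algebraMap R S (q.toRT r) := by
    rw [deriv_algebraMap, ← map_add, q.coe_toRT, add_sub_cancel]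
  induction l generalizing r with
  | nil =>
    rw [hr, add_mul, int_add, int_deriv_mul, pureTensor_nil, IDR.intTensor_one, map_add, map_sub,
      idrHom_ι, idrHom_ofEval, evalConstantsHom_evalEps, algebraMap_evalConst, q.coe_toRJ,
      ← mul_one (TensorAlgebra.ι (constants R) (q.toRT r)), idrHom_ofTensor, nestedIntegral_ι_mul]
    simp [int_zero]
  | cons a l ih =>
    rw [hr, add_mul, int_add, int_deriv_mul, pureTensor_cons, IDR.intTensor_ι_mul, map_add, map_sub,
      -- The decomposition `hr` depends on r and is carried through the induction, so it is proved
      -- again for the new coefficient.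
      map_sub, map_mul, ih _ (by
        rw [deriv_algebraMap, ← map_add, q.coe_toRT, add_sub_cancel]),
      idrHom_ι, idrHom_ofEval, evalConstantsHom_evalEps, algebraMap_evalConst, q.coe_toRJ,
      idrHom_ofTensor, idrHom_ofTensor, nestedIntegral_ι_mul _ _ (q.toRT r), nestedIntegral_ι_mul,
      deriv_int, map_mul, mul_assoc]

/-- Elements of C₁ and C₂ are mapped to constants of S, so they factor out of both operations. What
remains is r ⊗ t, treated by `idrHom_derivTensor` and `idrHom_intTensor`. -/
theorem isIntegroDiffHom_idrHom : IsIntegroDiffHom (idrHom q hRS hC : IDR q →+* S) := by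
  have hconst : ∀ c d, (idrHom q hRS hC (IDR.ofEval q c) * idrHom q hRS hC (IDR.ofProduct q d))′ =
      0 := fun c d => by
    rw [idrHom_ofEval, idrHom_ofProduct, ← map_mul, deriv_algebraMap_constants]
  refine ⟨fun x => ?_, fun x => ?_⟩
  · change idrHom q hRS hC (x′) = ((idrHom q hRS hC x)′)
    induction x using IDR.induction with
    | hadd x y hx hy => simp only [map_add, hx, hy]
    | h r c d l =>
      have h : IDR.ι q r * IDR.ofEval q c * IDR.ofProduct q d * IDR.ofTensor q (pureTensor l) =
        IDR.ofEval q c * IDR.ofProduct q d * (IDR.ι q r * IDR.ofTensor q (pureTensor l)) := by ring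
      rw [h, IDR.deriv_mul_const, IDR.deriv_ι_mul]
      simp only [map_mul, map_add, idrHom_derivTensor, idrHom_ofTensor, idrHom_ι]
      rw [Derivation.leibniz, hconst, Derivation.leibniz, deriv_algebraMap]
      simp only [smul_eq_mul]
      ring
  · change idrHom q hRS hC (IDR.intIDR q x) = int (idrHom q hRS hC x)
    induction x using IDR.induction with
    | hadd x y hx hy => simp only [map_add, int_add, hx, hy]
    | h r c d l =>
      have h : IDR.ι q r * IDR.ofEval q c * IDR.ofProduct q d * IDR.ofTensor q (pureTensor l) =
        IDR.ofEval q c * IDR.ofProduct q d * (IDR.ι q r * IDR.ofTensor q (pureTensor l)) := by ring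
      rw [h, IDR.intIDR_mul_const, IDR.intIDR_ι_mul, map_mul, map_mul, map_mul _ _ (_ * _),
        map_mul, int_const_mul (hconst c d), idrHom_intTensor, map_mul, idrHom_ι, idrHom_ofTensor]

end Homomorphism

/-! ### Normal forms modulo J and the kernel. -/

section NormalForm

variable {R : Type*} [CommRing R] [Differential R] (q : QuasiIntegration R)
  {I : Type*} (a : Module.Basis I (constants R) q.RT)

/-- Expand every factor of a pure tensor in the basis. This lets identities that are linear in a
tensor be checked on words, the only tensors for which J contains relations by definition. -/
theorem span_wordTensor :
    Submodule.span (constants R) (Set.range (wordTensor (q := q) a)) = ⊤ := by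
  rw [eq_top_iff]
  intro t _
  induction t using tensor_induction with
  | add x y hx hy => exact Submodule.add_mem _ (hx trivial) (hy trivial)
  | smul c x hx => exact Submodule.smul_mem _ c (hx trivial)
  | pure l =>
    induction l with
    | nil => exact Submodule.subset_span ⟨[], rfl⟩
    | cons b l ih =>
      have hb : TensorAlgebra.ι (constants R) b ∈ Submodule.span (constants R)
          (Set.range fun i => TensorAlgebra.ι (constants R) (a i)) := by
        have h := Submodule.apply_mem_span_image_of_mem_span
          (TensorAlgebra.ι (constants R) (M := q.RT)) (a.mem_span b)
        rwa [← Set.range_comp] at h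
      have h := Submodule.mul_mem_mul hb (ih trivial)
      rw [Submodule.span_mul_span] at h
      rw [pureTensor_cons]
      refine Submodule.span_mono ?_ h
      rintro _ ⟨_, ⟨i, rfl⟩, _, ⟨W, rfl⟩, rfl⟩
      exact ⟨i :: W, by simp [wordTensor]⟩

/-- The combination `∑ r_W ⊗ 1 ⊗ 1 ⊗ τ(W)` of tensors with coefficients in `R`. -/
def wordCombination : (List I →₀ R) →ₗ[constants R] IDR q :=
  Finsupp.lsum (constants R) fun W =>
    (LinearMap.mulRight (constants R) (IDR.ofTensor q (wordTensor a W))).comp (IDR.ι q).toLinearMap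

theorem wordCombination_single (W : List I) (r : R) :
    wordCombination q a (Finsupp.single W r) = IDR.ι q r * IDR.ofTensor q (wordTensor a W) := by
  rw [wordCombination, Finsupp.lsum_single]
  rfl

theorem ι_mul_ofTensor_mem_range (r : R) (t : TensorAlgebra (constants R) q.RT) :
    IDR.ι q r * IDR.ofTensor q t ∈ LinearMap.range (wordCombination q a) := by
  have ht : t ∈ Submodule.span (constants R) (Set.range (wordTensor (q := q) a)) := by
    rw [span_wordTensor]; trivial
  induction ht using Submodule.span_induction with
  | mem x h =>
    obtain ⟨W, rfl⟩ := h
    exact ⟨_, wordCombination_single q a W r⟩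
  | zero => simp
  | add x y _ _ hx hy => rw [map_add, mul_add]; exact Submodule.add_mem _ hx hy
  | smul c x _ hx => rw [map_smul, mul_smul_comm]; exact Submodule.smul_mem _ c hx

/-- Since Qb = 0 for b in R_T, only the last term of the integration formula survives. Thus tensors
are nested integrals already inside IDR(R), and their images under any homomorphism commuting with ∫
are determined by R. -/
theorem int_ι_mul_ofTensor (b : q.RT) (l : List q.RT) :
    int (IDR.ι q b * IDR.ofTensor q (pureTensor l)) =
      IDR.ofTensor q (TensorAlgebra.ι _ b * pureTensor l) := by
  have h := IDR.intTensor_RT q 1 b l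
  rw [one_smul, Subring.coe_one, one_mul] at h
  rw [IDR.int_def, IDR.intIDR_ι_mul, h]

/-- An integro-differential homomorphism is determined on tensors by its restriction to `R`. -/
theorem apply_wordCombination {S : Type*} [CommRing S] [Differential S] [Integration S]
    [Algebra R S] (φ : IDR q →+* S) (hφ : ∀ x, φ (int x) = int (φ x))
    (hι : ∀ r, φ (IDR.ι q r) = algebraMap R S r) (v : List I →₀ R) :
    φ (wordCombination q a v) = evalWords q S a v := by
  have hW : ∀ W : List I, φ (IDR.ofTensor q (wordTensor a W)) = wordIntegral q S a W := by
    intro W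
    induction W with
    | nil => exact (congrArg φ (IDR.ofTensor_one q)).trans (map_one φ)
    | cons i W ih =>
      rw [wordIntegral, ← ih, ← hι, ← map_mul, ← hφ, wordTensor, wordTensor, int_ι_mul_ofTensor]
      rfl
  induction v using Finsupp.induction_linear with
  | zero => simp
  | add v w hv hw => simp only [map_add, hv, hw]
  | single W r =>
    rw [wordCombination_single, map_mul, hι, hW, evalWords, Finsupp.linearCombination_single,
      Algebra.smul_def]

variable {S : Type*} [CommRing S] [Differential S] [Integration S] [Algebra R S]
  [DifferentialAlgebra R S] (hRS : Function.Injective (algebraMap R S))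
  (hC : ∀ x : S, x′ = 0 → ∃ c : constants R, algebraMap R S c = x)

/-- Both sides are algebra homomorphisms in c, so it suffices to compare them on the generators ε(f
⊗ τ(W)), where their difference is a generator of J. -/
theorem mk_ofEval (c : EvalConstants q) :
    Ideal.Quotient.mk (evaluationIdeal q S a) (IDR.ofEval q c) =
      Ideal.Quotient.mk _ (algebraMap (constants R) (IDR q) (evalConstantsHom q hRS hC c)) := by
  let F : EvalConstants q →ₐ[constants R] IDR q ⧸ evaluationIdeal q S a :=
    (Ideal.Quotient.mkₐ (constants R) _).comp (IDR.ofEval q)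
  let G : EvalConstants q →ₐ[constants R] IDR q ⧸ evaluationIdeal q S a :=
    (Ideal.Quotient.mkₐ (constants R) _).comp
      ((Algebra.ofId (constants R) (IDR q)).comp (evalConstantsHom q hRS hC))
  suffices h : F = G from DFunLike.congr_fun h c
  refine SymmetricAlgebra.algHom_ext (TensorProduct.ext (LinearMap.ext fun f =>
    LinearMap.ext_on_range (span_wordTensor q a) fun W => ?_))
  change Ideal.Quotient.mk (evaluationIdeal q S a) (IDR.ofEval q (evalEps q f (wordTensor a W))) =
    Ideal.Quotient.mk _ (algebraMap (constants R) (IDR q)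
      (evalConstantsHom q hRS hC (evalEps q f (wordTensor a W))))
  rw [Ideal.Quotient.eq, ← (IDR.ofEval q).commutes, ← map_sub]
  refine Ideal.subset_span (Or.inl ⟨f, W, _, ?_, rfl⟩)
  rw [evalConstantsHom_evalEps, nestedIntegral_wordTensor]
  exact algebraMap_evalConst hRS hC _

/-- By bilinearity the tensors may be taken to be words. For nonempty words the difference is a
generator of J. If one word is empty, J contains no generator for it, but both sides vanish by the
convention that ε is zero on degree zero. -/
theorem mk_ofProduct_productEps (f g : TensorAlgebra (constants R) q.RT) :
    Ideal.Quotient.mk (evaluationIdeal q S a) (IDR.ofProduct q (productEps _ _ f g)) =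
      Ideal.Quotient.mk _ (algebraMap (constants R) (IDR q)
        (productConstantsHom q hRS hC (productEps _ _ f g))) := by
  let F : ProductConstants (constants R) q.RT →ₗ[constants R] IDR q ⧸ evaluationIdeal q S a :=
    ((Ideal.Quotient.mkₐ (constants R) _).comp (IDR.ofProduct q)).toLinearMap
  let G : ProductConstants (constants R) q.RT →ₗ[constants R] IDR q ⧸ evaluationIdeal q S a :=
    ((Ideal.Quotient.mkₐ (constants R) _).comp
      ((Algebra.ofId (constants R) (IDR q)).comp (productConstantsHom q hRS hC))).toLinearMap
  suffices h : (productEps _ _).compr₂ F = (productEps _ _).compr₂ G from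
    LinearMap.congr_fun (LinearMap.congr_fun h f) g
  refine LinearMap.ext_on_range (span_wordTensor q a) fun U =>
    LinearMap.ext_on_range (span_wordTensor q a) fun V => ?_
  change F (productEps _ _ (wordTensor a U) (wordTensor a V)) =
    G (productEps _ _ (wordTensor a U) (wordTensor a V))
  cases U with
  | nil =>
    have : wordTensor a ([] : List I) = 1 := rfl
    rw [this, productEps_one_left, map_zero, map_zero]
  | cons i U =>
    cases V with
    | nil =>
      have : wordTensor a ([] : List I) = 1 := rfl
      rw [productEps_comm, this, productEps_one_left, map_zero, map_zero]
    | cons j V =>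
      have hpos : ∀ (i : I) (W : List I),
          nestedIntegral q S (positivePart _ _ (wordTensor a (i :: W))) =
            wordIntegral q S a (i :: W) := fun i W => by
        rw [← nestedIntegral_wordTensor, wordTensor, List.map_cons, pureTensor_cons,
          coe_positivePart_ι_mul]
      change Ideal.Quotient.mk (evaluationIdeal q S a) (IDR.ofProduct q _) =
        Ideal.Quotient.mk _ (algebraMap (constants R) (IDR q) (productConstantsHom q hRS hC _))
      rw [Ideal.Quotient.eq, ← (IDR.ofProduct q).commutes, ← map_sub]
      refine Ideal.subset_span (Or.inr ⟨i :: U, j :: V, _, by simp, by simp, ?_, rfl⟩)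
      rw [productConstantsHom_productEps, hpos, hpos]
      exact algebraMap_evalConst hRS hC _

theorem mk_ofProduct (d : ProductConstants (constants R) q.RT) :
    Ideal.Quotient.mk (evaluationIdeal q S a) (IDR.ofProduct q d) =
      Ideal.Quotient.mk _ (algebraMap (constants R) (IDR q) (productConstantsHom q hRS hC d)) := by
  let F : ProductConstants (constants R) q.RT →ₐ[constants R] IDR q ⧸ evaluationIdeal q S a :=
    (Ideal.Quotient.mkₐ (constants R) _).comp (IDR.ofProduct q)
  let G : ProductConstants (constants R) q.RT →ₐ[constants R] IDR q ⧸ evaluationIdeal q S a :=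
    (Ideal.Quotient.mkₐ (constants R) _).comp
      ((Algebra.ofId (constants R) (IDR q)).comp (productConstantsHom q hRS hC))
  suffices h : F = G from DFunLike.congr_fun h d
  exact productConstants_algHom_ext _ _ (mk_ofProduct_productEps q a hRS hC)

/-- Modulo the evaluation ideal, every element is a combination of words with coefficients
in `R`. -/
theorem exists_sub_wordCombination_mem (hRS : Function.Injective (algebraMap R S))
    (hC : ∀ x : S, x′ = 0 → ∃ c : constants R, algebraMap R S c = x) (x : IDR q) :
    ∃ v, x - wordCombination q a v ∈ evaluationIdeal q S a := by
  induction x using IDR.induction with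
  | hadd x y hx hy =>
    obtain ⟨v, hv⟩ := hx
    obtain ⟨w, hw⟩ := hy
    exact ⟨v + w, by rw [map_add, add_sub_add_comm]; exact Ideal.add_mem _ hv hw⟩
  | h r c d l =>
    obtain ⟨v, hv⟩ := ι_mul_ofTensor_mem_range q a r (pureTensor l)
    -- The factors from C₁ and C₂ are congruent modulo J to their values in C, which are absorbed as
    -- scalars into the coefficients.
    refine ⟨evalConstantsHom q hRS hC c • productConstantsHom q hRS hC d • v, ?_⟩
    rw [← Ideal.Quotient.eq, (wordCombination q a).map_smul, (wordCombination q a).map_smul, hv,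
      Algebra.smul_def, Algebra.smul_def]
    simp only [map_mul, mk_ofEval q a hRS hC, mk_ofProduct q a hRS hC]
    ring

/-- Each generator of J is a formal constant minus its value, and the homomorphism sends the formal
constant to exactly that value. -/
theorem evaluationIdeal_le_ker :
    evaluationIdeal q S a ≤ RingHom.ker (idrHom q hRS hC : IDR q →+* S) := by
  refine Ideal.span_le.mpr ?_
  rintro _ (⟨f, W, c, hc, rfl⟩ | ⟨U, V, c, hU, hV, hc, rfl⟩)
  · change idrHom q hRS hC _ = 0
    rw [idrHom_ofEval, map_sub, map_sub, AlgHom.commutes, evalConstantsHom_evalEps,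
      algebraMap_evalConst, nestedIntegral_wordTensor, sub_eq_zero]
    exact hc.symm
  · change idrHom q hRS hC _ = 0
    obtain ⟨i, U, rfl⟩ := List.exists_cons_of_ne_nil hU
    obtain ⟨j, V, rfl⟩ := List.exists_cons_of_ne_nil hV
    have hpos : ∀ (i : I) (W : List I),
        (positivePart _ _ (wordTensor a (i :: W)) : TensorAlgebra (constants R) q.RT) =
          wordTensor a (i :: W) := fun i W => by
      rw [wordTensor, List.map_cons, pureTensor_cons, coe_positivePart_ι_mul]
    rw [idrHom_ofProduct, map_sub, map_sub, AlgHom.commutes, productConstantsHom_productEps,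
      algebraMap_evalConst, hpos, hpos, nestedIntegral_wordTensor, nestedIntegral_wordTensor,
      sub_eq_zero]
    exact hc.symm

/-- Modulo J an element of the kernel is a combination of words. Since J lies in the kernel, the
corresponding combination of nested integrals vanishes, and linear independence makes all
coefficients zero. -/
theorem ker_idrHom
    (hR : ∀ f : R, f ≠ 0 → ∃ c ∈ differentialIdeal f, c ≠ 0 ∧ c ∈ constants R) :
    RingHom.ker (idrHom q hRS hC : IDR q →+* S) = evaluationIdeal q S a := by
  refine le_antisymm (fun x hx => ?_) (evaluationIdeal_le_ker q a hRS hC)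
  obtain ⟨v, hv⟩ := exists_sub_wordCombination_mem q a hRS hC x
  have h := evaluationIdeal_le_ker q a hRS hC hv
  rw [RingHom.mem_ker, map_sub, RingHom.mem_ker.mp hx, zero_sub, neg_eq_zero,
    apply_wordCombination q a _ (isIntegroDiffHom_idrHom q hRS hC).2 (idrHom_ι q hRS hC)] at h
  have hv0 : v = 0 := evalWords_injective q S a hRS hR (h.trans (map_zero _).symm)
  rwa [hv0, map_zero, sub_zero] at hv

end NormalForm

/-! ### The internal closure as an extension of R. -/

section InternalClosure

variable (R S : Type*) [CommRing R] [CommRing S] [Algebra R S] [Differential S] [Integration S]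

/-- Allows the homomorphism to be built with the closure itself as target. The absence of new
constants is assumed there only, not in S. -/
instance : Algebra R (internalClosure R S) :=
  ((algebraMap R S).codRestrict (internalClosure R S)
    (algebraMap_mem_internalClosure R S)).toAlgebra

theorem coe_algebraMap_internalClosure (r : R) :
    (algebraMap R (internalClosure R S) r : S) = algebraMap R S r := rfl

instance [Differential R] [DifferentialAlgebra R S] :
    DifferentialAlgebra R (internalClosure R S) where
  deriv_algebraMap r := Subtype.ext (deriv_algebraMap (B := S) r)

theorem coe_eval_internalClosure (x : internalClosure R S) :
    ((eval x : internalClosure R S) : S) = eval (x : S) := rfl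

variable {R} [Differential R] (q : QuasiIntegration R) {I : Type*} (a : I → q.RT)

theorem coe_wordIntegral_internalClosure (W : List I) :
    (wordIntegral q (internalClosure R S) a W : S) = wordIntegral q S a W := by
  induction W with
  | nil => rfl
  | cons i W ih =>
    rw [wordIntegral, wordIntegral, coe_int_internalClosure, Subring.coe_mul, ih]
    rfl

/-- Nested integrals and evaluations in the closure are those of S, and the inclusion is injective,
so both ideals have the same generators. -/
theorem evaluationIdeal_internalClosure :
    evaluationIdeal q (internalClosure R S) a = evaluationIdeal q S a := by
  simp only [evaluationIdeal, evalRelations, productRelations, Subtype.ext_iff,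
    coe_algebraMap_internalClosure, coe_eval_internalClosure, Subring.coe_mul,
    coe_wordIntegral_internalClosure]

end InternalClosure

end IntegroDiff

end

/-! ### The isomorphism onto the internal closure and its uniqueness. -/

theorem mainTheorem5 {R : Type*} {S : Type*} {I : Type*} [CommRing R] [Differential R]
    (q : IntegroDiff.QuasiIntegration R)
    [CommRing S] [Differential S] [IntegroDiff.Integration S]
    [Algebra R S] [DifferentialAlgebra R S] (hRS : Function.Injective (algebraMap R S))
    (hconst : (IntegroDiff.constants (IntegroDiff.internalClosure R S)).map
        (IntegroDiff.internalClosure R S).subtype =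
      (IntegroDiff.constants R).map (algebraMap R S))
    (a : Module.Basis I (IntegroDiff.constants R) q.RT)
    (hR : ∀ f : R, f ≠ 0 →
      ∃ c ∈ IntegroDiff.differentialIdeal f, c ≠ 0 ∧ c ∈ IntegroDiff.constants R) :
    ∃ e : (IntegroDiff.IDR q ⧸ IntegroDiff.evaluationIdeal q S a) ≃+*
        IntegroDiff.internalClosure R S,
      IntegroDiff.IsIntegroDiffHom e.toRingHom ∧
      (∀ f : R, (e (Ideal.Quotient.mk _ (IntegroDiff.IDR.ι q f)) : S) = algebraMap R S f) ∧
      ∀ ψ : (IntegroDiff.IDR q ⧸ IntegroDiff.evaluationIdeal q S a) →+* S,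
        IntegroDiff.IsIntegroDiffHom ψ →
        (∀ f : R, ψ (Ideal.Quotient.mk _ (IntegroDiff.IDR.ι q f)) = algebraMap R S f) →
        ∀ x, ψ x = (e x : S) := by
  have hRS' : Function.Injective (algebraMap R (IntegroDiff.internalClosure R S)) := fun x y h =>
    hRS (congrArg Subtype.val h)
  have hC : ∀ x : IntegroDiff.internalClosure R S,
      Differential.deriv x = 0 →
        ∃ c : IntegroDiff.constants R, algebraMap R (IntegroDiff.internalClosure R S) c = x := by
    intro x hx
    have h : (x : S) ∈ (IntegroDiff.constants R).map (algebraMap R S) := by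
      rw [← hconst]
      exact ⟨x, hx, rfl⟩
    obtain ⟨c, hc, hcx⟩ := h
    exact ⟨⟨c, hc⟩, Subtype.ext hcx⟩
  let η : IntegroDiff.IDR q →+* IntegroDiff.internalClosure R S :=
    (IntegroDiff.idrHom q hRS' hC : IntegroDiff.IDR q →+* IntegroDiff.internalClosure R S)
  have hη : IntegroDiff.IsIntegroDiffHom η := IntegroDiff.isIntegroDiffHom_idrHom q hRS' hC
  have hηι : ∀ r, η (IntegroDiff.IDR.ι q r) = algebraMap R (IntegroDiff.internalClosure R S) r :=
    IntegroDiff.idrHom_ι q hRS' hC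
  have hker : IntegroDiff.evaluationIdeal q S a = RingHom.ker η := by
    rw [← IntegroDiff.evaluationIdeal_internalClosure]
    exact (IntegroDiff.ker_idrHom q a hRS' hC hR).symm
  have hsurj : Function.Surjective η := by
    -- The image is a subring of S that contains R and is closed under ∂ and ∫, so it is one of the
    -- subrings whose intersection defines the closure.
    have hle : IntegroDiff.internalClosure R S ≤
        ((IntegroDiff.internalClosure R S).subtype.comp η).range := by
      refine sInf_le ⟨?_, ?_, ?_⟩
      · rintro _ ⟨r, rfl⟩
        exact ⟨IntegroDiff.IDR.ι q r, congrArg Subtype.val (hηι r)⟩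
      · rintro _ ⟨x, rfl⟩
        exact ⟨Differential.deriv x, congrArg Subtype.val (hη.1 x)⟩
      · rintro _ ⟨x, rfl⟩
        exact ⟨IntegroDiff.int x, congrArg Subtype.val (hη.2 x)⟩
    intro y
    obtain ⟨x, hx⟩ := hle y.2
    exact ⟨x, Subtype.ext hx⟩
  let e := (Ideal.quotEquivOfEq hker).trans (RingHom.quotientKerEquivOfSurjective hsurj)
  have he : ∀ x, e (Ideal.Quotient.mk _ x) = η x := fun _ => rfl
  refine ⟨e, ⟨fun x => ?_, fun x => ?_⟩, fun f => ?_, fun ψ hψ hψι x => ?_⟩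
  · obtain ⟨x, rfl⟩ := Ideal.Quotient.mk_surjective x
    exact hη.1 x
  · obtain ⟨x, rfl⟩ := Ideal.Quotient.mk_surjective x
    exact hη.2 x
  · exact congrArg Subtype.val (hηι f)
  · obtain ⟨x, rfl⟩ := Ideal.Quotient.mk_surjective x
    -- For uniqueness, x is replaced by its normal form. Both homomorphisms commute with ∫ and agree
    -- on R, so both map it to the same combination ∑ r_W σ(W) in S.
    obtain ⟨v, hv⟩ := IntegroDiff.exists_sub_wordCombination_mem q a hRS' hC x
    rw [IntegroDiff.evaluationIdeal_internalClosure, ← Ideal.Quotient.eq] at hv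
    rw [hv, he]
    have h1 := IntegroDiff.apply_wordCombination q a (ψ.comp (Ideal.Quotient.mk _))
      (fun x => hψ.2 (Ideal.Quotient.mk _ x)) hψι v
    have h2 := IntegroDiff.apply_wordCombination q a
      ((IntegroDiff.internalClosure R S).subtype.comp η)
      (fun x => congrArg Subtype.val (hη.2 x)) (fun r => congrArg Subtype.val (hηι r)) v
    exact h1.trans h2.symm
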